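/- **Setting.** Let $N\ge1$, $0=d_0<d_1<\dots<d_{N-1}<d_N=+\infty$, and for $n=1,\dots,N$ let $\zeta_n^{\rm L}(r)=A_n^{\rm L}r^{-\alpha_n^{\rm L}}$ and $\zeta_n^{\rm NL}(r)=A_n^{\rm NL}r^{-\alpha_n^{\rm NL}}$ with $A_n^{\rm L},A_n^{\rm NL},\alpha_n^{\rm L},\alpha_n^{\rm NL}>0$, and let ${\rm Pr}_n^{\rm L}:(d_{n-1},d_n]\to[0,1]$ be nonincreasing (for $n=N$ read $(d_{N-1},\infty)$). Let $\zeta^{\rm L},\zeta^{\rm NL},{\rm Pr}^{\rm L}$ be the functions on $(0,\infty)$ that coincide with $\zeta_n^{\rm L},\zeta_n^{\rm NL},{\rm Pr}_n^{\rm L}$ on $(d_{n-1},d_n]$; $\zeta^{\rm L}$ and $\zeta^{\rm NL}$ are assumed to be nonincreasing (a longer link of the same type is never stronger). Let $\lambda>0$, $0\le\tilde\lambda\le\lambda$, $P>0$, $P_{\rm N}\ge0$, $\gamma>0$. Base stations (BSs) $b_1,b_2,\dots$ form a homogeneous Poisson point process (HPPP) $\Phi$ of density $\lambda$ on $\mathbb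 R^2$, and the typical user is at the origin. Given their positions, and independently for different BSs, a BS at distance $u$ has a line-of-sight (LoS) link to the user, with path loss $\beta=\zeta^{\rm L}(u)$, with probability ${\rm Pr}^{\rm L}(u)$, and otherwise a non-line-of-sight (NLoS) link with $\beta=\zeta^{\rm NL}(u)$; its fading gain $g$ is exponential with mean one (Rayleigh fading); and it is active with probability $\tilde\lambda/\lambda$. These three attributes are independent of each other, and activity and fading are independent of the positions; so the active BSs form an HPPP $\tilde\Phi\subset\Phi$ of density $\tilde\lambda$. The user is served by the BS $b_o\in\Phi$ with the largest $\beta$ (the strongest link). With $$I_{\rm agg}=\sum_{b_i\in\tilde\Phi\setminus b_o}P\beta_ig_i,\qquad {\rm SINR}=\frac{P\beta_{b_o}g_{b_o}}{I_{\rm agg}+P_{\rm N}},\qquad p^{\rm cov}(\lambda,\gamma)={\rm Pr}[{\rm SINR}>\gamma],$$ the following hold. **Theorem.** Almost surely, the serving BS $b_o$ exists and is unique, and $$p^{\rm cov}(\lambda,\gamma)=\sum_{n=1}^N\left(T_n^{\rm L}+T_n^{\rm NL}\right),\qquad T_n^{\rm L}=\int_{d_{n-1}}^{d_n}q_n^{\rm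 L}(r)f_{R,n}^{\rm L}(r)\,dr,\quad T_n^{\rm NL}=\int_{d_{n-1}}^{d_n}q_n^{\rm NL}(r)f_{R,n}^{\rm NL}(r)\,dr .$$ Here $f_{R,n}^{\rm L}$ is the density on $(d_{n-1},d_n]$ of the distance to the serving BS on the event that the serving link is LoS, $q_n^{\rm L}(r)={\rm Pr}\left[\frac{P\zeta_n^{\rm L}(r)h}{I_{\rm agg}+P_{\rm N}}>\gamma\right]$, with $h=g_{b_o}$, is the conditional probability of $\{{\rm SINR}>\gamma\}$ given that the serving link is LoS with length $r$, and $\mathscr L^{\rm L}(s)$, $s>0$, is the conditional Laplace transform of $I_{\rm agg}$ given the same; similarly for NL. They are given, for $d_{n-1}<r\le d_n$, by $$f_{R,n}^{\rm L}(r)=\exp\left(-\int_0^{r_1}(1-{\rm Pr}^{\rm L}(u))2\pi u\lambda\,du\right)\exp\left(-\int_0^{r}{\rm Pr}^{\rm L}(u)2\pi u\lambda\,du\right){\rm Pr}_n^{\rm L}(r)\,2\pi r\lambda,$$ $$f_{R,n}^{\rm NL}(r)=\exp\left(-\int_0^{r_2}{\rm Pr}^{\rm L}(u)2\pi u\lambda\,du\right)\exp\left(-\int_0^{r}(1-{\rm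 Pr}^{\rm L}(u))2\pi u\lambda\,du\right)(1-{\rm Pr}_n^{\rm L}(r))\,2\pi r\lambda,$$ $$q_n^{\rm L}(r)=\exp\left(-\frac{\gamma P_{\rm N}}{P\zeta_n^{\rm L}(r)}\right)\mathscr L^{\rm L}\left(\frac{\gamma}{P\zeta_n^{\rm L}(r)}\right),\qquad q_n^{\rm NL}(r)=\exp\left(-\frac{\gamma P_{\rm N}}{P\zeta_n^{\rm NL}(r)}\right)\mathscr L^{\rm NL}\left(\frac{\gamma}{P\zeta_n^{\rm NL}(r)}\right),$$ $$\mathscr L^{\rm L}(s)=\exp\left(-2\pi\tilde\lambda\int_r^\infty\frac{{\rm Pr}^{\rm L}(u)\,u}{1+(sP\zeta^{\rm L}(u))^{-1}}du\right)\exp\left(-2\pi\tilde\lambda\int_{r_1}^\infty\frac{(1-{\rm Pr}^{\rm L}(u))\,u}{1+(sP\zeta^{\rm NL}(u))^{-1}}du\right),$$ $$\mathscr L^{\rm NL}(s)=\exp\left(-2\pi\tilde\lambda\int_{r_2}^\infty\frac{{\rm Pr}^{\rm L}(u)\,u}{1+(sP\zeta^{\rm L}(u))^{-1}}du\right)\exp\left(-2\pi\tilde\lambda\int_{r}^\infty\frac{(1-{\rm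 Pr}^{\rm L}(u))\,u}{1+(sP\zeta^{\rm NL}(u))^{-1}}du\right),$$ with $e^{-\infty}=0$ and $0\cdot\infty=0$, where $r_1$ and $r_2$ are the solutions of $\zeta^{\rm NL}(r_1)=\zeta_n^{\rm L}(r)$ and $\zeta^{\rm L}(r_2)=\zeta_n^{\rm NL}(r)$. A solution is unique if it exists, and it exists when $\zeta^{\rm NL}$, respectively $\zeta^{\rm L}$, is continuous on $(0,\infty)$. In general $r_1=\sup\{x>0:\zeta^{\rm NL}(x)\ge\zeta_n^{\rm L}(r)\}$ and $r_2=\sup\{x>0:\zeta^{\rm L}(x)\ge\zeta_n^{\rm NL}(r)\}$. -/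

import Mathlib

open MeasureTheory ProbabilityTheory Set
open scoped ENNReal

/-- The plane in which base stations (BSs) are deployed; the typical user is at the origin. -/
abbrev Plane : Type := EuclideanSpace ℝ (Fin 2)

/-- The type of a link: line of sight or non line of sight. -/
inductive LinkType : Type
  | los : LinkType
  | nlos : LinkType

/-- The opposite link type. -/
def LinkType.other : LinkType → LinkType
  | .los => .nlos
  | .nlos => .los

/-! ### The piecewise path-loss model -/

/-- Data of an `N`-piece path-loss model.  The breakpoints are `d 0 < d 1 < ⋯ < d N`,
the coefficients are `A p n` and the exponents are `α p n`, and `prLoS n` is the LoS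
probability function of piece `n`.  Pieces are numbered from `0`. -/
structure PathLossModel (N : ℕ) where
  d : Fin (N + 1) → EReal
  A : LinkType → Fin N → ℝ
  α : LinkType → Fin N → ℝ
  prLoS : Fin N → ℝ → ℝ

namespace PathLossModel

variable {N : ℕ} (M : PathLossModel N)

/-- The range of distances `(d_n, d_{n+1}]` of piece `n`. -/
def piece (n : Fin N) : Set ℝ :=
  {r | M.d n.castSucc < (r : EReal) ∧ (r : EReal) ≤ M.d n.succ}

/-- The piecewise function equal to `f n` on piece `n`
(and `0` at nonpositive arguments, which do not matter). -/
noncomputable def stack (f : Fin N → ℝ → ℝ) (r : ℝ) : ℝ :=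
  ∑ n, (M.piece n).indicator (f n) r

/-- `ζ_n^p (r) = A_n^p r ^ (-α_n^p)`. -/
noncomputable def zetaPiece (p : LinkType) (n : Fin N) (r : ℝ) : ℝ :=
  M.A p n * r ^ (-(M.α p n))

/-- The stacked function `ζ^p`. -/
noncomputable def zeta (p : LinkType) : ℝ → ℝ := M.stack (M.zetaPiece p)

/-- The probability that a link of length `r` in piece `n` has type `p`. -/
def linkProbPiece (p : LinkType) (n : Fin N) (r : ℝ) : ℝ :=
  match p with
  | .los => M.prLoS n r
  | .nlos => 1 - M.prLoS n r

/-- The stacked link-type probability: `Pr^L` for `los` and `1 - Pr^L` for `nlos`. -/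
noncomputable def linkProb (p : LinkType) : ℝ → ℝ := M.stack (M.linkProbPiece p)

/-- The standing assumptions on the path-loss model. -/
structure IsValid : Prop where
  d_zero : M.d 0 = 0
  d_last : M.d (Fin.last N) = ⊤
  d_strictMono : StrictMono M.d
  A_pos : ∀ p n, 0 < M.A p n
  α_pos : ∀ p n, 0 < M.α p n
  /-- A longer link of the same type is never stronger. -/
  zeta_antitone : ∀ p, AntitoneOn (M.zeta p) (Ioi 0)
  prLoS_mem : ∀ n, ∀ r ∈ M.piece n, M.prLoS n r ∈ Icc (0 : ℝ) 1
  prLoS_antitone : ∀ n, AntitoneOn (M.prLoS n) (M.piece n)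

/-- For a link of type `p` and length `r` in piece `n`, the distance at which a link of the
other type has the same path loss, i.e. the solution `x` of `ζ^{other p} (x) = ζ_n^p (r)`
(`r₁` for `p = los` and `r₂` for `p = nlos`).  It is written as a generalized inverse so that
it also makes sense when `ζ^{other p}` jumps over the value `ζ_n^p (r)`. -/
noncomputable def crossing (p : LinkType) (n : Fin N) (r : ℝ) : ℝ :=
  sSup {x : ℝ | 0 < x ∧ M.zetaPiece p n r ≤ M.zeta p.other x}

end PathLossModel

/-- `exp (-x)` for `x ∈ [0, ∞]`, with `exp (-∞) = 0`. -/
noncomputable def expNeg (x : ℝ≥0∞) : ℝ≥0∞ := EReal.exp (-(x : EReal))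

/-! ### The random network -/

/-- The point process (random counting measure) formed by the points `X i`. -/
noncomputable def pointProcess {Ω : Type*} (X : ℕ → Ω → Plane) (ω : Ω) : Measure Plane :=
  Measure.sum fun i => Measure.dirac (X i ω)

/-- The points `X i` form a homogeneous Poisson point process of density `lam`: the number of
points in a Borel set of finite area is Poisson with mean `lam` times the area, and the numbers
of points in disjoint sets are independent. -/
structure IsHPPP {Ω : Type*} [MeasurableSpace Ω] (μ : Measure Ω) (lam : ℝ)
    (X : ℕ → Ω → Plane) : Prop where
  measurable : ∀ i, Measurable (X i)
  hasLaw : ∀ B : Set Plane, MeasurableSet B → volume B ≠ ∞ →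
    HasLaw (fun ω => pointProcess X ω B)
      ((poissonMeasure (lam * volume.real B).toNNReal).map (fun k : ℕ => (k : ℝ≥0∞))) μ
  indep : ∀ (m : ℕ) (B : Fin m → Set Plane), (∀ j, MeasurableSet (B j)) →
    (∀ j, volume (B j) ≠ ∞) → Pairwise (fun i j => Disjoint (B i) (B j)) →
    iIndepFun (fun j ω => pointProcess X ω (B j)) μ

/-- Random variables describing the network: BS `i` is located at `loc i`, `mark i` decides the
type of its link to the typical user, `active i` tells whether it is active, and `gain i` is
the multi-path fading gain of its link to the typical user. -/
structure Network (Ω : Type*) where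
  loc : ℕ → Ω → Plane
  mark : ℕ → Ω → ℝ
  active : ℕ → Ω → Bool
  gain : ℕ → Ω → ℝ

/-- Law of the attributes (link mark, activity, fading gain) of one BS: they are independent,
uniform on `[0,1]`, Bernoulli with success probability `lamA / lam`, and exponential with
mean one. -/
noncomputable def attributeLaw (lam lamA : ℝ) : Measure (ℝ × Bool × ℝ) :=
  (volume.restrict (Icc (0 : ℝ) 1)).prod
    ((ENNReal.ofReal (lamA / lam) • Measure.dirac true +
      ENNReal.ofReal (1 - lamA / lam) • Measure.dirac false).prod (expMeasure 1))

/-- The BSs form an HPPP of density `lam`; the attributes of the BSs are i.i.d. and independent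
of the locations.  In particular the active BSs are an independent thinning of the BSs, and so
form an HPPP of density `lamA`. -/
structure Network.IsModel {Ω : Type*} [MeasurableSpace Ω] (S : Network Ω) (μ : Measure Ω)
    (lam lamA : ℝ) : Prop where
  hppp : IsHPPP μ lam S.loc
  law : ∀ i, HasLaw (fun ω => (S.mark i ω, S.active i ω, S.gain i ω)) (attributeLaw lam lamA) μ
  measurable : ∀ i, Measurable (fun ω => (S.mark i ω, S.active i ω, S.gain i ω))
  iid : iIndepFun (fun i ω => (S.mark i ω, S.active i ω, S.gain i ω)) μ
  indep : IndepFun (fun ω i => S.loc i ω)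
    (fun ω i => (S.mark i ω, S.active i ω, S.gain i ω)) μ

namespace Network

variable {Ω : Type*} (S : Network Ω) {N : ℕ} (M : PathLossModel N)

/-- Distance from BS `i` to the typical user. -/
noncomputable def dist (i : ℕ) (ω : Ω) : ℝ := ‖S.loc i ω‖

open Classical in
/-- Type of the link from BS `i` to the typical user: LoS with probability `Pr^L` evaluated at
the distance. -/
noncomputable def path (i : ℕ) (ω : Ω) : LinkType :=
  if S.mark i ω ≤ M.linkProb .los (S.dist i ω) then .los else .nlos

/-- The path loss `ζ` (a power gain: larger is stronger) of the link from BS `i`. -/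
noncomputable def beta (i : ℕ) (ω : Ω) : ℝ := M.zeta (S.path M i ω) (S.dist i ω)

/-- BS `i` offers the strongest link to the typical user. -/
def IsStrongest (i : ℕ) (ω : Ω) : Prop := ∀ j, S.beta M j ω ≤ S.beta M i ω

/-- The serving BS: the one with the strongest link. -/
noncomputable def serving (ω : Ω) : ℕ := sInf {i | S.IsStrongest M i ω}

/-- The serving distance. -/
noncomputable def servingDist (ω : Ω) : ℝ := S.dist (S.serving M ω) ω

/-- The type of the serving link. -/
noncomputable def servingPath (ω : Ω) : LinkType := S.path M (S.serving M ω) ω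

open Classical in
/-- Aggregate interference: total power received from the active BSs other than the serving
BS, when every BS transmits with power `P`. -/
noncomputable def interference (P : ℝ) (ω : Ω) : ℝ≥0∞ :=
  ∑' i, if S.active i ω = true ∧ i ≠ S.serving M ω
    then ENNReal.ofReal (P * S.beta M i ω * S.gain i ω) else 0

/-- The signal to interference plus noise ratio, for noise power `PN`. -/
noncomputable def sinr (P PN : ℝ) (ω : Ω) : ℝ≥0∞ :=
  ENNReal.ofReal (P * S.beta M (S.serving M ω) ω * S.gain (S.serving M ω) ω) /
    (S.interference M P ω + ENNReal.ofReal PN)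

/-- The coverage probability `Pr[SINR > γ]`. -/
noncomputable def coverage [MeasurableSpace Ω] (μ : Measure Ω) (P PN γ : ℝ) : ℝ≥0∞ :=
  μ {ω | ENNReal.ofReal γ < S.sinr M P PN ω}

/-- The event that the serving link has type `p` and its length lies in `B`. -/
def servedIn (p : LinkType) (B : Set ℝ) : Set Ω :=
  {ω | S.servingPath M ω = p ∧ S.servingDist M ω ∈ B}

end Network

/-! ### The analytical expressions -/

namespace PathLossModel

variable {N : ℕ} (M : PathLossModel N)

/-- `f_{R,n}^p (r)`. -/
noncomputable def servingDensity (lam : ℝ) (p : LinkType) (n : Fin N) (r : ℝ) : ℝ :=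
  Real.exp (-∫ u in (0 : ℝ)..M.crossing p n r,
      M.linkProb p.other u * (2 * Real.pi * u * lam)) *
    Real.exp (-∫ u in (0 : ℝ)..r, M.linkProb p u * (2 * Real.pi * u * lam)) *
    M.linkProbPiece p n r * (2 * Real.pi * r * lam)

/-- `∫_a^∞ q(u) u / (1 + (s P ζ^p(u))⁻¹) du`, where `q` is the probability of link type `p`. -/
noncomputable def interferenceIntegral (P s : ℝ) (p : LinkType) (a : ℝ) : ℝ≥0∞ :=
  ∫⁻ u in Ioi a, ENNReal.ofReal (M.linkProb p u * u / (1 + (s * P * M.zeta p u)⁻¹))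

/-- The Laplace transform of the interference at `s`, given a serving link of type `p` and of
length `r` in piece `n`. -/
noncomputable def laplace (lamA P : ℝ) (p : LinkType) (n : Fin N) (r s : ℝ) : ℝ≥0∞ :=
  expNeg (ENNReal.ofReal (2 * Real.pi * lamA) * M.interferenceIntegral P s p r) *
    expNeg (ENNReal.ofReal (2 * Real.pi * lamA) *
      M.interferenceIntegral P s p.other (M.crossing p n r))

/-- The probability of `SINR > γ`, given a serving link of type `p` and of length `r` in
piece `n`. -/
noncomputable def successProb (lamA P PN γ : ℝ) (p : LinkType) (n : Fin N) (r : ℝ) : ℝ≥0∞ :=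
  ENNReal.ofReal (Real.exp (-(γ * PN / (P * M.zetaPiece p n r)))) *
    M.laplace lamA P p n r (γ / (P * M.zetaPiece p n r))

/-- `T_n^p`. -/
noncomputable def T (lam lamA P PN γ : ℝ) (p : LinkType) (n : Fin N) : ℝ≥0∞ :=
  ∫⁻ r in M.piece n, M.successProb lamA P PN γ p n r *
    ENNReal.ofReal (M.servingDensity lam p n r)

end PathLossModel

/-!
The expected number of base stations with a given property is computed with the Mecke formula of the
Poisson process. Since almost surely exactly one base station is the strongest, the probability of
an event involving the serving base station is the sum over all base stations `i` of the probability
of the event with "serving" replaced by `i`, restricted to "no other base station is stronger than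
`i`". Both this restriction and the exponential of the interference of the others are products
over the other base stations, and so the theorem reduces to expectations of such products.

*Mecke formula.* For `H : Plane → [0, 1]` and a Borel set `A`, the sum over `i` of the expectation
of `∏_{j ≠ i} H (X j)` on the event `X i ∈ A` is `lam * |A| * exp (-lam ∫ (1 - H))`
(`IsHPPP.mecke`). For a step function this is a computation with independent Poisson counts, and the
general case follows by monotone approximation. Here the functional also depends on the distance `r`
of the selected point, through the threshold `ζ(r)` and the argument `γ / (P ζ(r))` of the Laplace
transform. This dependence is monotone in `r`, so on a short range of distances both sides are
squeezed between values at the endpoints (`IsHPPP.mecke_radial`); no Mecke formula for general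
functionals is needed.

*Marks.* The attributes are independent of the positions, so each factor may be replaced by its mean
(`meanFactor`). With a unit exponential gain, an active base station with path loss `β` contributes
`1 / (1 + s P β)`, and polar coordinates turn `exp (-lam ∫ (1 - H))` into void probabilities up to
the distances at which either link type reaches the threshold, times the Laplace transform of the
interference from beyond (`expNeg_lintegral_meanFactor`). The tail of the gain of the selected base
station is itself exponential, which turns the coverage probability into a Laplace transform at
`γ / (P ζ(r))` (`tsum_measure_selectedIn_inter`).

*Uniqueness.* The path loss is strictly decreasing, so for each link type at most one distance
attains a given threshold, and the formula is the same whether the others are required to be weaker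
or strictly weaker. The two expected numbers of base stations agree and are finite on bounded sets,
hence ties have probability zero (`ae_selectedIn_lt_of_le`).
-/

/-! ### The exponential of a negative extended number -/

lemma continuous_expNeg : Continuous expNeg :=
  ENNReal.continuous_exp.comp (continuous_neg.comp continuous_coe_ennreal_ereal)

@[fun_prop]
lemma measurable_expNeg : Measurable expNeg := continuous_expNeg.measurable

lemma antitone_expNeg : Antitone expNeg := fun x y h => by
  unfold expNeg
  exact EReal.exp_monotone (EReal.neg_le_neg_iff.2 (EReal.coe_ennreal_le_coe_ennreal_iff.2 h))

@[simp] lemma expNeg_zero : expNeg 0 = 1 := by simp [expNeg]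

@[simp] lemma expNeg_top : expNeg ∞ = 0 := by simp [expNeg]

lemma expNeg_le_one (x : ℝ≥0∞) : expNeg x ≤ 1 := by
  rw [← expNeg_zero]; exact antitone_expNeg zero_le

lemma expNeg_ofReal {x : ℝ} (hx : 0 ≤ x) :
    expNeg (ENNReal.ofReal x) = ENNReal.ofReal (Real.exp (-x)) := by
  rw [expNeg, EReal.coe_ennreal_ofReal, max_eq_left hx, ← EReal.coe_neg, EReal.exp_coe]

lemma expNeg_add (x y : ℝ≥0∞) : expNeg (x + y) = expNeg x * expNeg y := by
  induction x with
  | top => simp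
  | coe x =>
    induction y with
    | top => simp
    | coe y =>
      rw [← ENNReal.ofReal_coe_nnreal, ← ENNReal.ofReal_coe_nnreal, ← ENNReal.ofReal_add (by simp)
        (by simp), expNeg_ofReal (by positivity), expNeg_ofReal (by simp), expNeg_ofReal (by simp),
        ← ENNReal.ofReal_mul (by positivity), ← Real.exp_add]
      congr 2; ring

lemma expNeg_sum {ι : Type*} (s : Finset ι) (x : ι → ℝ≥0∞) :
    expNeg (∑ i ∈ s, x i) = ∏ i ∈ s, expNeg (x i) := by
  classical
  induction s using Finset.induction_on with
  | empty => simp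
  | insert a s ha ih => rw [Finset.sum_insert ha, Finset.prod_insert ha, expNeg_add, ih]

/-! ### Infinite products of numbers in the unit interval -/

/-- The infinite product of a sequence of numbers in `[0, 1]`, as the infimum of its partial
products. -/
noncomputable def infProd (a : ℕ → ℝ≥0∞) : ℝ≥0∞ := ⨅ n, ∏ j ∈ Finset.range n, a j

section InfProd

variable {a b : ℕ → ℝ≥0∞}

lemma antitone_prod_range (ha : ∀ j, a j ≤ 1) :
    Antitone fun n => ∏ j ∈ Finset.range n, a j :=
  antitone_nat_of_succ_le fun n => by
    rw [Finset.prod_range_succ]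
    exact mul_le_of_le_one_right' (ha n)

lemma infProd_le_one (a : ℕ → ℝ≥0∞) : infProd a ≤ 1 :=
  (iInf_le _ 0).trans (by simp)

lemma infProd_mono (h : ∀ j, a j ≤ b j) : infProd a ≤ infProd b :=
  iInf_mono fun _ => Finset.prod_le_prod' fun j _ => h j

lemma tendsto_infProd (ha : ∀ j, a j ≤ 1) :
    Filter.Tendsto (fun n => ∏ j ∈ Finset.range n, a j) Filter.atTop (nhds (infProd a)) :=
  tendsto_atTop_iInf (antitone_prod_range ha)

lemma infProd_eq_prod (ha : ∀ j, a j ≤ 1) (s : Finset ℕ) (hs : ∀ j ∉ s, a j = 1) :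
    infProd a = ∏ j ∈ s, a j := by
  obtain ⟨n, hn⟩ : ∃ n, s ⊆ Finset.range n := s.exists_nat_subset_range
  refine tendsto_nhds_unique (tendsto_infProd ha) (tendsto_atTop_of_eventually_const (i₀ := n) ?_)
  intro m hm
  refine (Finset.prod_subset (hn.trans (Finset.range_mono hm)) ?_).symm
  exact fun j _ hj => hs j hj

lemma infProd_mul (ha : ∀ j, a j ≤ 1) (hb : ∀ j, b j ≤ 1) :
    infProd (fun j => a j * b j) = infProd a * infProd b := by
  have hab : ∀ j, a j * b j ≤ 1 := fun j => mul_le_one' (ha j) (hb j)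
  refine tendsto_nhds_unique (tendsto_infProd hab) ?_
  simp only [Finset.prod_mul_distrib]
  exact ENNReal.Tendsto.mul (tendsto_infProd ha)
    (Or.inr ((infProd_le_one b).trans_lt ENNReal.one_lt_top).ne) (tendsto_infProd hb)
    (Or.inr ((infProd_le_one a).trans_lt ENNReal.one_lt_top).ne)

open Classical in
lemma infProd_indicator (p : ℕ → Prop) :
    infProd (fun j => if p j then 1 else 0) = if ∀ j, p j then 1 else 0 := by
  split_ifs with h
  · simp [infProd, h]
  · obtain ⟨j, hj⟩ := not_forall.1 h
    refine le_antisymm ((iInf_le _ (j + 1)).trans ?_) zero_le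
    rw [Finset.prod_eq_zero (Finset.self_mem_range_succ j) (by simp [hj])]

lemma expNeg_tsum (x : ℕ → ℝ≥0∞) : expNeg (∑' j, x j) = infProd fun j => expNeg (x j) := by
  refine tendsto_nhds_unique ?_ (tendsto_infProd fun j => expNeg_le_one (x j))
  simp only [← expNeg_sum]
  exact (continuous_expNeg.tendsto _).comp (ENNReal.summable.hasSum.tendsto_sum_nat)

lemma infProd_iInf {f : ℕ → ℕ → ℝ≥0∞} (hf : ∀ n j, f n j ≤ 1)
    (hanti : ∀ j, Antitone fun n => f n j) :
    infProd (fun j => ⨅ n, f n j) = ⨅ n, infProd (f n) := by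
  unfold infProd
  rw [iInf_comm]
  refine iInf_congr fun m => ?_
  refine tendsto_nhds_unique (f := fun n => ∏ j ∈ Finset.range m, f n j) (l := Filter.atTop) ?_
    (tendsto_atTop_iInf fun n n' h => Finset.prod_le_prod' fun j _ => hanti j h)
  refine ENNReal.tendsto_finsetProd_of_ne_top _ (fun j _ => tendsto_atTop_iInf (hanti j)) ?_
  exact fun j _ => ((iInf_le _ 0).trans (hf 0 j)).trans_lt ENNReal.one_lt_top |>.ne

lemma measurable_infProd {α : Type*} [MeasurableSpace α] {f : ℕ → α → ℝ≥0∞}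
    (hf : ∀ j, Measurable (f j)) : Measurable fun x => infProd fun j => f j x :=
  Measurable.iInf fun _ => Finset.measurable_prod _ fun j _ => hf j

lemma update_one_le_one (ha : ∀ j, a j ≤ 1) (i j : ℕ) : Function.update a i 1 j ≤ 1 := by
  by_cases h : j = i
  · subst h; simp
  · simpa [h] using ha j

lemma update_one_mono (hab : ∀ j, a j ≤ b j) (i j : ℕ) :
    Function.update a i 1 j ≤ Function.update b i 1 j := by
  by_cases h : j = i
  · subst h; simp
  · simpa [h] using hab j

/-- The expectation of an infinite product of independent factors is the product of the
expectations. -/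
lemma lintegral_infProd {Ω : Type*} [MeasurableSpace Ω] {μ : Measure Ω}
    {Y : ℕ → Ω → ℝ≥0∞} (hY : iIndepFun Y μ) (hm : ∀ j, Measurable (Y j)) (h1 : ∀ j ω, Y j ω ≤ 1) :
    ∫⁻ ω, infProd (fun j => Y j ω) ∂μ = infProd fun j => ∫⁻ ω, Y j ω ∂μ := by
  have : IsProbabilityMeasure μ := hY.isProbabilityMeasure
  unfold infProd
  rw [lintegral_iInf (fun n => Finset.measurable_prod _ fun j _ => hm j)
    (fun _ _ h ω => antitone_prod_range (fun j => h1 j ω) h) (by simp)]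
  exact iInf_congr fun _ => lintegral_prod_eq_prod_lintegral_of_indepFun _ _ hY hm

end InfProd

/-! ### Poisson counts -/

/-- The probability generating function of the Poisson distribution. -/
lemma tsum_poisson_mul_pow {m : ℝ} (hm : 0 ≤ m) {c : ℝ≥0∞} (hc : c ≤ 1) :
    ∑' k : ℕ, ENNReal.ofReal (Real.exp (-m) * m ^ k / k.factorial) * c ^ k =
      expNeg (ENNReal.ofReal m * (1 - c)) := by
  lift c to NNReal using (hc.trans_lt ENNReal.one_lt_top).ne
  have hc' : (c : ℝ) ≤ 1 := by exact_mod_cast hc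
  have h1 : ∀ k : ℕ, ENNReal.ofReal (Real.exp (-m) * m ^ k / k.factorial) * (c : ℝ≥0∞) ^ k =
      ENNReal.ofReal (Real.exp (-m) * ((m * c) ^ k / k.factorial)) := fun k => by
    rw [← ENNReal.ofReal_coe_nnreal, ← ENNReal.ofReal_pow (by positivity),
      ← ENNReal.ofReal_mul (by positivity)]
    congr 1
    rw [mul_pow]; ring
  have hs := (NormedSpace.expSeries_div_hasSum_exp (m * c : ℝ)).mul_left (Real.exp (-m))
  rw [← Real.exp_eq_exp_ℝ, ← Real.exp_add] at hs
  simp_rw [h1]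
  rw [← ENNReal.ofReal_tsum_of_nonneg (fun k => by positivity) hs.summable, hs.tsum_eq,
    ← ENNReal.ofReal_coe_nnreal, ← ENNReal.ofReal_one, ← ENNReal.ofReal_sub _ (by positivity),
    ← ENNReal.ofReal_mul hm, expNeg_ofReal (mul_nonneg hm (by linarith))]
  congr 2; ring

/-- The derivative of the probability generating function of the Poisson distribution. -/
lemma tsum_poisson_mul_nat_mul_pow {m : ℝ} (hm : 0 ≤ m) {c : ℝ≥0∞} (hc : c ≤ 1) :
    ∑' k : ℕ, ENNReal.ofReal (Real.exp (-m) * m ^ k / k.factorial) * (k * c ^ (k - 1)) =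
      ENNReal.ofReal m * expNeg (ENNReal.ofReal m * (1 - c)) := by
  rw [tsum_eq_zero_add' ENNReal.summable, ← tsum_poisson_mul_pow hm hc, ← ENNReal.tsum_mul_left]
  simp only [Nat.cast_zero, zero_mul, mul_zero, zero_add]
  refine tsum_congr fun k => ?_
  rw [Nat.add_sub_cancel, ← mul_assoc, ← mul_assoc]
  congr 1
  rw [← ENNReal.ofReal_mul hm, ← ENNReal.ofReal_natCast (k + 1),
    ← ENNReal.ofReal_mul (by positivity)]
  congr 1
  rw [Nat.factorial_succ]
  push_cast
  field_simp
  ring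

section Poisson

variable {Ω : Type*} {X : ℕ → Ω → Plane}

lemma pointProcess_apply (ω : Ω) {B : Set Plane} (hB : MeasurableSet B) :
    pointProcess X ω B = {i | X i ω ∈ B}.encard := by
  rw [pointProcess, Measure.sum_apply _ hB, ← ENNReal.tsum_set_one,
    tsum_subtype {i | X i ω ∈ B} fun _ => (1 : ℝ≥0∞)]
  refine tsum_congr fun i => ?_
  rw [Measure.dirac_apply' _ hB]
  rfl

lemma finite_of_pointProcess_ne_top {ω : Ω} {B : Set Plane} (hB : MeasurableSet B)
    (h : pointProcess X ω B ≠ ∞) : {i | X i ω ∈ B}.Finite := by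
  rw [pointProcess_apply ω hB] at h
  exact Set.encard_ne_top_iff.1 fun h' => h (by rw [h']; rfl)

/-- The pointwise identity behind the Mecke formula for a step function `H`: the sum over the
points in one cell factorizes over the cells. -/
lemma tsum_infProd_eq_prod {ι : Type*} [Fintype ι] [DecidableEq ι] {ω : Ω} {B : ι → Set Plane}
    (hB : ∀ k, MeasurableSet (B k)) (hd : Pairwise fun k l => Disjoint (B k) (B l))
    (hfin : ∀ k, pointProcess X ω (B k) ≠ ∞) {val : ι → ℝ≥0∞} (hval : ∀ k, val k ≤ 1)
    {H : Plane → ℝ≥0∞} (hH : ∀ k, ∀ x ∈ B k, H x = val k) (hH' : ∀ x, (∀ k, x ∉ B k) → H x = 1)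
    (k₀ : ι) :
    ∑' i, (X i ⁻¹' B k₀).indicator
        (fun ω => infProd (Function.update (fun j => H (X j ω)) i 1)) ω =
      ∏ k, (fun x : ℝ≥0∞ => if k = k₀ then (⌊x.toReal⌋₊ : ℝ≥0∞) * val k ^ (⌊x.toReal⌋₊ - 1)
        else val k ^ ⌊x.toReal⌋₊) (pointProcess X ω (B k)) := by
  classical
  have hf : ∀ k, {i | X i ω ∈ B k}.Finite := fun k =>
    finite_of_pointProcess_ne_top (hB k) (hfin k)
  let J : ι → Finset ℕ := fun k => (hf k).toFinset
  have hJ : ∀ k i, i ∈ J k ↔ X i ω ∈ B k := fun k i => by simp [J]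
  have hcard : ∀ k, ⌊(pointProcess X ω (B k)).toReal⌋₊ = (J k).card := fun k => by
    rw [pointProcess_apply ω (hB k), (hf k).encard_eq_coe_toFinset_card]
    simp [J]
  have hdisj : ∀ k l, k ≠ l → Disjoint (J k) (J l) := fun k l hkl =>
    Finset.disjoint_left.2 fun i hk hl =>
      Set.disjoint_left.1 (hd hkl) ((hJ k i).1 hk) ((hJ l i).1 hl)
  have hH1 : ∀ x, H x ≤ 1 := fun x => by
    by_cases hx : ∃ k, x ∈ B k
    · obtain ⟨k, hk⟩ := hx
      rw [hH k x hk]; exact hval k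
    · rw [hH' x (not_exists.1 hx)]
  have hprod : ∀ i ∈ J k₀, infProd (Function.update (fun j => H (X j ω)) i 1) =
      ∏ k, val k ^ (if k = k₀ then (J k).card - 1 else (J k).card) := by
    intro i hi
    rw [infProd_eq_prod (update_one_le_one (fun j => hH1 _) i)
      (Finset.univ.biUnion fun k => (J k).erase i), Finset.prod_biUnion]
    · refine Finset.prod_congr rfl fun k _ => ?_
      rw [Finset.prod_congr rfl (g := fun _ => val k), Finset.prod_const]
      · split_ifs with hk
        · subst hk; rw [Finset.card_erase_of_mem hi]
        · rw [Finset.erase_eq_of_notMem]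
          exact fun h => Finset.disjoint_left.1 (hdisj k k₀ hk) h hi
      · intro j hj
        rw [Finset.mem_erase] at hj
        rw [Function.update_of_ne hj.1]
        exact hH k _ ((hJ k j).1 hj.2)
    · intro k _ l _ hkl
      exact (hdisj k l hkl).mono (Finset.erase_subset _ _) (Finset.erase_subset _ _)
    · intro j hj
      by_cases hji : j = i
      · simp [hji]
      · rw [Function.update_of_ne hji]
        refine hH' _ fun k hk => hj ?_
        simp only [Finset.mem_biUnion, Finset.mem_univ, true_and]
        exact ⟨k, Finset.mem_erase.2 ⟨hji, (hJ k j).2 hk⟩⟩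
  rw [tsum_eq_sum (s := J k₀), Finset.sum_congr rfl
    (g := fun _ => ∏ k, val k ^ (if k = k₀ then (J k).card - 1 else (J k).card)),
    Finset.sum_const, nsmul_eq_mul]
  · rw [← Finset.mul_prod_erase _ _ (Finset.mem_univ k₀),
      ← Finset.mul_prod_erase _ _ (Finset.mem_univ k₀), ← mul_assoc]
    simp only [if_true, hcard]
    congr 1
    refine Finset.prod_congr rfl fun k hk => ?_
    simp [(Finset.mem_erase.1 hk).1]
  · intro i hi
    rw [indicator_of_mem (show ω ∈ X i ⁻¹' B k₀ from (hJ k₀ i).1 hi), hprod i hi]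
  · intro i hi
    exact indicator_of_notMem (fun h : ω ∈ X i ⁻¹' B k₀ => hi ((hJ k₀ i).2 h)) _

variable [MeasurableSpace Ω] {μ : Measure Ω} {lam : ℝ}

namespace IsHPPP

lemma lintegral_count (hX : IsHPPP μ lam X) (hlam : 0 ≤ lam) {B : Set Plane}
    (hB : MeasurableSet B) (hv : volume B ≠ ∞) {f : ℝ≥0∞ → ℝ≥0∞} (hf : Measurable f) :
    ∫⁻ ω, f (pointProcess X ω B) ∂μ = ∑' k : ℕ, ENNReal.ofReal
      (Real.exp (-(lam * volume.real B)) * (lam * volume.real B) ^ k / k.factorial) * f k := by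
  rw [(hX.hasLaw B hB hv).lintegral_comp hf.aemeasurable, lintegral_map hf (by fun_prop),
    poissonMeasure, lintegral_sum_measure]
  refine tsum_congr fun k => ?_
  rw [lintegral_smul_measure, lintegral_dirac, Real.coe_toNNReal _ (by positivity)]
  rfl

lemma ae_count_ne_top (hX : IsHPPP μ lam X) {B : Set Plane}
    (hB : MeasurableSet B) (hv : volume B ≠ ∞) : ∀ᵐ ω ∂μ, pointProcess X ω B ≠ ∞ := by
  have h := hX.hasLaw B hB hv
  rw [h.ae_iff (p := fun x => x ≠ ∞) (measurableSet_setOfPred.1 (measurableSet_singleton ∞).compl)]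
  refine (ae_map_iff (by fun_prop) (measurableSet_singleton ∞).compl).2 ?_
  simp

lemma iIndepFun_count (hX : IsHPPP μ lam X) {ι : Type*} [Fintype ι] {B : ι → Set Plane}
    (hB : ∀ k, MeasurableSet (B k)) (hv : ∀ k, volume (B k) ≠ ∞)
    (hd : Pairwise fun k l => Disjoint (B k) (B l)) :
    iIndepFun (fun k ω => pointProcess X ω (B k)) μ := by
  have h := hX.indep (Fintype.card ι) (fun j => B ((Fintype.equivFin ι).symm j))
    (fun j => hB _) (fun j => hv _)
    (fun i j hij => hd ((Fintype.equivFin ι).symm.injective.ne hij))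
  have h2 := h.precomp (Fintype.equivFin ι).injective
  simpa using h2

/-- The Mecke formula for a function `H` that is constant on each of finitely many disjoint cells
and equal to `1` outside of them, with the selected point in one of the cells: the counts in the cells
are independent, the selected cell contributes the derivative of its generating function and the
other cells their generating functions. -/
lemma mecke_cell (hX : IsHPPP μ lam X) (hlam : 0 ≤ lam) {ι : Type*} [Fintype ι]
    {B : ι → Set Plane}
    (hB : ∀ k, MeasurableSet (B k)) (hd : Pairwise fun k l => Disjoint (B k) (B l))
    (hv : ∀ k, volume (B k) ≠ ∞) {val : ι → ℝ≥0∞} (hval : ∀ k, val k ≤ 1)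
    {H : Plane → ℝ≥0∞} (hHm : Measurable H)
    (hH : ∀ k, ∀ x ∈ B k, H x = val k) (hH' : ∀ x, (∀ k, x ∉ B k) → H x = 1)
    (k₀ : ι) :
    ∑' i, ∫⁻ ω in X i ⁻¹' B k₀, infProd (Function.update (fun j => H (X j ω)) i 1) ∂μ =
      ENNReal.ofReal lam * volume (B k₀) * expNeg (ENNReal.ofReal lam * ∫⁻ x, (1 - H x)) := by
  classical
  have hFm : ∀ i, Measurable fun ω => infProd (Function.update (fun j => H (X j ω)) i 1) := by
    intro i
    refine measurable_infProd (f := fun j ω => Function.update (fun j => H (X j ω)) i 1 j) ?_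
    intro j
    by_cases hj : j = i
    · subst hj; simp
    · simp only [Function.update_of_ne hj]
      exact hHm.comp (hX.measurable j)
  have hms : ∀ i, MeasurableSet (X i ⁻¹' B k₀) := fun i => hX.measurable i (hB k₀)
  simp_rw [← lintegral_indicator (hms _)]
  rw [← lintegral_tsum fun i => ((hFm i).indicator (hms i)).aemeasurable]
  have hae : ∀ᵐ ω ∂μ, ∀ k, pointProcess X ω (B k) ≠ ∞ :=
    ae_all_iff.2 fun k => hX.ae_count_ne_top (hB k) (hv k)
  rw [lintegral_congr_ae (hae.mono fun ω hω => tsum_infProd_eq_prod hB hd hω hval hH hH' k₀)]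
  have hfm : ∀ k, Measurable fun x : ℝ≥0∞ =>
      if k = k₀ then (⌊x.toReal⌋₊ : ℝ≥0∞) * val k ^ (⌊x.toReal⌋₊ - 1)
        else val k ^ ⌊x.toReal⌋₊ := by
    intro k
    have h1 : Measurable fun x : ℝ≥0∞ => ⌊x.toReal⌋₊ := ENNReal.measurable_toReal.nat_floor
    split_ifs
    · exact (measurable_from_top (f := fun n : ℕ => (n : ℝ≥0∞) * val k ^ (n - 1))).comp h1
    · exact (measurable_from_top (f := fun n : ℕ => val k ^ n)).comp h1
  have hcm : ∀ k, Measurable fun ω => pointProcess X ω (B k) := by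
    intro k
    simp only [pointProcess, Measure.sum_apply _ (hB k)]
    refine Measurable.tsum fun i => ?_
    simp only [Measure.dirac_apply' _ (hB k)]
    exact (measurable_one.indicator (hB k)).comp (hX.measurable i)
  have hind := (hX.iIndepFun_count hB hv hd).comp _ hfm
  have := lintegral_prod_eq_prod_lintegral_of_indepFun Finset.univ _ hind
    (fun k => (hfm k).comp (hcm k))
  simp only [Function.comp_def] at this
  rw [this]
  have hk : ∀ k, ∫⁻ ω, (fun x : ℝ≥0∞ =>
      if k = k₀ then (⌊x.toReal⌋₊ : ℝ≥0∞) * val k ^ (⌊x.toReal⌋₊ - 1)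
        else val k ^ ⌊x.toReal⌋₊) (pointProcess X ω (B k)) ∂μ =
      (if k = k₀ then ENNReal.ofReal lam * volume (B k) else 1) *
        expNeg (ENNReal.ofReal lam * ((1 - val k) * volume (B k))) := by
    intro k
    rw [hX.lintegral_count hlam (hB k) (hv k) (hfm k)]
    have e1 : ENNReal.ofReal (lam * volume.real (B k)) = ENNReal.ofReal lam * volume (B k) := by
      rw [ENNReal.ofReal_mul hlam, ofReal_measureReal (hv k)]
    have e2 : ENNReal.ofReal lam * ((1 - val k) * volume (B k)) =
      ENNReal.ofReal lam * volume (B k) * (1 - val k) := by ring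
    by_cases h : k = k₀
    · simp only [h, if_true, ENNReal.toReal_natCast, Nat.floor_natCast]
      rw [← h, tsum_poisson_mul_nat_mul_pow (by positivity) (hval k), e1, e2]
    · simp only [h, if_false, ENNReal.toReal_natCast, Nat.floor_natCast, one_mul]
      rw [tsum_poisson_mul_pow (by positivity) (hval k), e1, e2]
  rw [Finset.prod_congr rfl fun k _ => hk k, Finset.prod_mul_distrib, ← expNeg_sum,
    ← Finset.mul_sum, Finset.prod_ite_eq' Finset.univ k₀ fun k => ENNReal.ofReal lam * volume (B k)]
  simp only [Finset.mem_univ, if_true]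
  congr 3
  have : ∀ x, 1 - H x = ∑ k, (B k).indicator (fun _ => 1 - val k) x := by
    intro x
    by_cases hx : ∃ k, x ∈ B k
    · obtain ⟨k, hk⟩ := hx
      rw [Finset.sum_eq_single k]
      · rw [indicator_of_mem hk, hH k x hk]
      · intro l _ hl
        exact indicator_of_notMem (fun h => Set.disjoint_left.1 (hd hl) h hk) _
      · simp
    · rw [hH' x (not_exists.1 hx), tsub_self, Finset.sum_eq_zero]
      exact fun k _ => indicator_of_notMem (not_exists.1 hx k) _
  simp_rw [this]
  rw [lintegral_finsetSum _ fun k _ => measurable_const.indicator (hB k)]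
  refine Finset.sum_congr rfl fun k _ => ?_
  rw [lintegral_indicator_const (hB k)]

end IsHPPP

end Poisson

/-! ### The Mecke formula -/

/-- A measurable function with values in `[0, 1]` is the decreasing limit of simple functions
that are equal to `1` outside of a ball. -/
lemma exists_simpleFunc_iInf_eq {H : Plane → ℝ≥0∞} (hHm : Measurable H) (hH1 : ∀ x, H x ≤ 1) :
    ∃ K : ℕ → SimpleFunc Plane ℝ≥0∞, Antitone (fun n x => K n x) ∧ (∀ n x, K n x ≤ 1) ∧
      (∀ n : ℕ, ∀ x ∉ Metric.closedBall (0 : Plane) n, K n x = 1) ∧ ∀ x, ⨅ n, K n x = H x := by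
  have hm : Measurable fun x => 1 - H x := hHm.const_sub 1
  let G : ℕ → SimpleFunc Plane ℝ≥0∞ := fun n =>
    (SimpleFunc.eapprox (fun x => 1 - H x) n).restrict (Metric.closedBall 0 n)
  have hG : ∀ n x, G n x = (Metric.closedBall (0 : Plane) n).indicator
      (SimpleFunc.eapprox (fun x => 1 - H x) n) x := fun n x =>
    SimpleFunc.restrict_apply _ Metric.isClosed_closedBall.measurableSet x
  have hGle : ∀ n x, G n x ≤ SimpleFunc.eapprox (fun x => 1 - H x) n x := fun n x => by
    rw [hG]; exact indicator_le_self _ _ x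
  have hmono : ∀ x, Monotone fun n => G n x := by
    intro x n m hnm
    simp only [hG]
    refine (indicator_le_indicator (SimpleFunc.monotone_eapprox _ hnm x)).trans ?_
    exact indicator_le_indicator_of_subset
      (Metric.closedBall_subset_closedBall (by exact_mod_cast hnm)) (fun _ => zero_le) x
  have hsup : ∀ x, ⨆ n, G n x = 1 - H x := by
    intro x
    rw [← SimpleFunc.iSup_eapprox_apply hm x]
    refine le_antisymm (iSup_mono fun n => hGle n x) (iSup_le fun n => ?_)
    obtain ⟨m, hm⟩ := exists_nat_ge ‖x‖
    refine le_iSup_of_le (max n m) ?_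
    rw [hG, indicator_of_mem]
    · exact SimpleFunc.monotone_eapprox _ (le_max_left n m) x
    · rw [mem_closedBall_zero_iff]
      exact hm.trans (by exact_mod_cast le_max_right n m)
  refine ⟨fun n => (G n).map (1 - ·), fun n m hnm x => ?_, fun n x => ?_, fun n x hx => ?_,
    fun x => ?_⟩
  · simpa using tsub_le_tsub_left (hmono x hnm) 1
  · simp
  · simp only [SimpleFunc.map_apply, hG, indicator_of_notMem hx, tsub_zero]
  · simp only [SimpleFunc.map_apply]
    rw [← ENNReal.sub_iSup ENNReal.one_ne_top, hsup, ENNReal.sub_sub_cancel ENNReal.one_ne_top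
      (hH1 x)]

lemma tsum_iInf_of_antitone {f : ℕ → ℕ → ℝ≥0∞} (hf : ∀ i, Antitone fun n => f n i)
    (h0 : ∑' i, f 0 i ≠ ∞) : ∑' i, ⨅ n, f n i = ⨅ n, ∑' i, f n i := by
  have h := lintegral_iInf (μ := Measure.count) (f := f) (fun n => measurable_from_top)
    (fun n m hnm i => hf i hnm) (by rwa [lintegral_count])
  simpa only [lintegral_count] using h

section Poisson

variable {Ω : Type*} {X : ℕ → Ω → Plane} [MeasurableSpace Ω] {μ : Measure Ω} {lam : ℝ}

namespace IsHPPP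

lemma measurable_infProd_update (hX : IsHPPP μ lam X) {H : Plane → ℝ≥0∞} (hHm : Measurable H)
    (i : ℕ) : Measurable fun ω => infProd (Function.update (fun j => H (X j ω)) i 1) := by
  refine measurable_infProd (f := fun j ω => Function.update (fun j => H (X j ω)) i 1 j) ?_
  intro j
  by_cases hj : j = i
  · subst hj; simp
  · simp only [Function.update_of_ne hj]
    exact hHm.comp (hX.measurable j)

lemma mecke_simpleFunc (hX : IsHPPP μ lam X) (hlam : 0 ≤ lam) {H : SimpleFunc Plane ℝ≥0∞}
    (hH1 : ∀ x, H x ≤ 1) {D : Set Plane} (hD : MeasurableSet D) (hDv : volume D ≠ ∞)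
    (hHD : ∀ x ∉ D, H x = 1) {A : Set Plane} (hA : MeasurableSet A) (hAv : volume A ≠ ∞) :
    ∑' i, ∫⁻ ω in X i ⁻¹' A, infProd (Function.update (fun j => H (X j ω)) i 1) ∂μ =
      ENNReal.ofReal lam * volume A * expNeg (ENNReal.ofReal lam * ∫⁻ x, (1 - H x)) := by
  classical
  have hmv : ∀ v, MeasurableSet (H ⁻¹' {v}) := fun v => H.measurableSet_preimage _
  let E : Bool → Set Plane := fun b => if b then A else D \ A
  have hE : ∀ b, MeasurableSet (E b) := fun b => by
    cases b <;> simp [E, hA, hD.diff hA]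
  have hEv : ∀ b, volume (E b) ≠ ∞ := fun b => by
    cases b
    · exact measure_ne_top_of_subset sdiff_subset hDv
    · exact hAv
  let B : H.range × Bool → Set Plane := fun k => H ⁻¹' {k.1.1} ∩ E k.2
  have hB : ∀ k, MeasurableSet (B k) := fun k => (hmv _).inter (hE _)
  have hBv : ∀ k, volume (B k) ≠ ∞ := fun k => measure_ne_top_of_subset inter_subset_right (hEv _)
  have hBd : Pairwise fun k l => Disjoint (B k) (B l) := by
    rintro ⟨v, b⟩ ⟨w, c⟩ hkl
    rw [Set.disjoint_left]
    rintro x ⟨hx1, hx2⟩ ⟨hx3, hx4⟩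
    apply hkl
    have hvw : v = w := Subtype.ext (hx1.symm.trans hx3)
    have hbc : b = c := by
      cases b <;> cases c <;> simp_all [E]
    rw [hvw, hbc]
  have hval : ∀ k : H.range × Bool, k.1.1 ≤ 1 := by
    rintro ⟨⟨v, hv⟩, b⟩
    obtain ⟨x, rfl⟩ := SimpleFunc.mem_range.1 hv
    exact hH1 x
  have hout : ∀ x, (∀ k, x ∉ B k) → H x = 1 := by
    intro x hx
    by_contra h1
    have hxD : x ∈ D := by_contra fun h => h1 (hHD x h)
    have hxE : ∃ b, x ∈ E b := by
      by_cases hxA : x ∈ A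
      · exact ⟨true, hxA⟩
      · exact ⟨false, hxD, hxA⟩
    obtain ⟨b, hb⟩ := hxE
    exact hx (⟨H x, H.mem_range_self x⟩, b) ⟨rfl, hb⟩
  have hcell := fun v : H.range => hX.mecke_cell hlam hB hBd hBv hval H.measurable
    (fun k x hx => hx.1) hout (v, true)
  have hAU : A = ⋃ v : H.range, B (v, true) := by
    ext x
    simp only [mem_iUnion]
    refine ⟨fun h => ⟨⟨H x, H.mem_range_self x⟩, rfl, h⟩, ?_⟩
    rintro ⟨v, _, h⟩
    exact h
  have hdU : Pairwise fun v w : H.range => Disjoint (B (v, true)) (B (w, true)) := fun v w h =>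
    hBd fun h' => h (congrArg Prod.fst h')
  have hvA : volume A = ∑' v : H.range, volume (B (v, true)) := by
    conv_lhs => rw [hAU]
    exact measure_iUnion hdU fun v => hB _
  have hsplit : ∀ i, ∫⁻ ω in X i ⁻¹' A, infProd (Function.update (fun j => H (X j ω)) i 1) ∂μ =
      ∑' v : H.range, ∫⁻ ω in X i ⁻¹' B (v, true),
        infProd (Function.update (fun j => H (X j ω)) i 1) ∂μ := by
    intro i
    conv_lhs => rw [hAU, preimage_iUnion]
    exact lintegral_iUnion (fun v => hX.measurable i (hB _))
      (fun v w h => (hdU h).preimage _) _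
  simp_rw [hsplit]
  rw [ENNReal.tsum_comm]
  simp_rw [hcell]
  rw [ENNReal.tsum_mul_right, ENNReal.tsum_mul_left, hvA]

/-- The expected number of points in a Borel set. -/
lemma tsum_measure_preimage (hX : IsHPPP μ lam X) (hlam : 0 ≤ lam) {A : Set Plane}
    (hA : MeasurableSet A) (hAv : volume A ≠ ∞) :
    ∑' i, μ (X i ⁻¹' A) = ENNReal.ofReal lam * volume A := by
  have h := hX.mecke_simpleFunc hlam (H := SimpleFunc.const _ 1) (by simp) MeasurableSet.empty
    (by simp) (by simp) hA hAv
  have h2 : infProd (fun _ => 1) = 1 := by simp [infProd]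
  simpa [h2] using h

/-- The Mecke formula for a product functional: a point of the process at `x` does not change the
law of the remaining points, and the expectation of `∏ H (X j)` over a Poisson process is
`exp (-lam ∫ (1 - H))`. -/
theorem mecke (hX : IsHPPP μ lam X) [IsProbabilityMeasure μ] (hlam : 0 ≤ lam)
    {H : Plane → ℝ≥0∞} (hHm : Measurable H)
    (hH1 : ∀ x, H x ≤ 1) {A : Set Plane} (hA : MeasurableSet A) (hAv : volume A ≠ ∞) :
    ∑' i, ∫⁻ ω in X i ⁻¹' A, infProd (Function.update (fun j => H (X j ω)) i 1) ∂μ =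
      ENNReal.ofReal lam * volume A * expNeg (ENNReal.ofReal lam * ∫⁻ x, (1 - H x)) := by
  obtain ⟨K, hKa, hK1, hKD, hKH⟩ := exists_simpleFunc_iInf_eq hHm hH1
  have hstep := fun n => hX.mecke_simpleFunc hlam (hK1 n)
    Metric.isClosed_closedBall.measurableSet measure_closedBall_lt_top.ne (hKD n) hA hAv
  have hKm : ∀ n, Measurable (K n) := fun n => (K n).measurable
  -- the integrand decreases to its limit
  have hF : ∀ i ω, infProd (Function.update (fun j => H (X j ω)) i 1) =
      ⨅ n, infProd (Function.update (fun j => K n (X j ω)) i 1) := by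
    intro i ω
    rw [← infProd_iInf (fun n => update_one_le_one (fun j => hK1 n _) i)]
    · congr 1
      funext j
      by_cases hj : j = i
      · subst hj; simp
      · simp only [Function.update_of_ne hj, hKH]
    · exact fun j n m hnm => update_one_mono (fun j => hKa hnm _) i j
  have hint : ∀ i, ∫⁻ ω in X i ⁻¹' A, infProd (Function.update (fun j => H (X j ω)) i 1) ∂μ =
      ⨅ n, ∫⁻ ω in X i ⁻¹' A, infProd (Function.update (fun j => K n (X j ω)) i 1) ∂μ := by
    intro i
    simp_rw [hF]
    refine lintegral_iInf (fun n => hX.measurable_infProd_update (hKm n) i)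
      (fun n m hnm ω => infProd_mono fun j => update_one_mono (fun j => hKa hnm _) i j) ?_
    refine ((lintegral_mono fun ω => infProd_le_one _).trans_lt ?_).ne
    simp
  have hsum : ∑' i, ∫⁻ ω in X i ⁻¹' A, infProd (Function.update (fun j => H (X j ω)) i 1) ∂μ =
      ⨅ n, ∑' i, ∫⁻ ω in X i ⁻¹' A, infProd (Function.update (fun j => K n (X j ω)) i 1) ∂μ := by
    simp_rw [hint]
    refine tsum_iInf_of_antitone (fun i n m hnm => lintegral_mono fun ω =>
      infProd_mono fun j => update_one_mono (fun j => hKa hnm _) i j) ?_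
    refine ((ENNReal.tsum_le_tsum fun i => lintegral_mono fun ω => infProd_le_one _).trans_lt
      ?_).ne
    simp only [lintegral_const, one_mul, Measure.restrict_apply_univ,
      hX.tsum_measure_preimage hlam hA hAv]
    exact ENNReal.mul_lt_top ENNReal.ofReal_lt_top hAv.lt_top
  rw [hsum]
  simp_rw [hstep]
  have hlim : ∫⁻ x, (1 - H x) = ⨆ n, ∫⁻ x, (1 - K n x) := by
    rw [← lintegral_iSup (fun n => (hKm n).const_sub 1)
      fun n m hnm x => tsub_le_tsub_left (hKa hnm x) 1]
    refine lintegral_congr fun x => ?_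
    rw [← hKH x, ENNReal.sub_iInf]
  have hmono : Monotone fun n => ENNReal.ofReal lam * ∫⁻ x, (1 - K n x) := fun n m hnm =>
    mul_le_mul_right (lintegral_mono fun x => tsub_le_tsub_left (hKa hnm x) 1) _
  rw [hlim, ENNReal.mul_iSup]
  refine iInf_eq_of_tendsto (fun n m hnm => mul_le_mul_right (antitone_expNeg (hmono hnm)) _) ?_
  refine ENNReal.Tendsto.const_mul ((continuous_expNeg.tendsto _).comp
    (tendsto_atTop_iSup hmono)) (Or.inr ?_)
  exact (ENNReal.mul_lt_top ENNReal.ofReal_lt_top hAv.lt_top).ne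

end IsHPPP

end Poisson

/-! ### A squeeze argument for measures on the line -/

lemma measure_inter_Ioc_eq_sum (ν : Measure ℝ) {B : Set ℝ} (hB : MeasurableSet B) {t : ℕ → ℝ}
    (ht : Monotone t) (n : ℕ) :
    ν (B ∩ Ioc (t 0) (t n)) = ∑ k ∈ Finset.range n, ν (B ∩ Ioc (t k) (t (k + 1))) := by
  induction n with
  | zero => simp
  | succ n ih =>
    rw [Finset.sum_range_succ, ← ih, ← measure_union _ (hB.inter measurableSet_Ioc),
      ← inter_union_distrib_left, Ioc_union_Ioc_eq_Ioc (ht n.zero_le) (ht n.le_succ)]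
    refine Set.disjoint_left.2 fun x hx hx' => ?_
    exact absurd hx.2.2 (not_le.2 hx'.2.1)

lemma sum_tsub_succ_add_eq {f : ℕ → ℝ≥0∞} (hf : Antitone f) (n : ℕ) :
    ∑ k ∈ Finset.range n, (f k - f (k + 1)) + f n = f 0 := by
  induction n with
  | zero => simp
  | succ n ih => rw [Finset.sum_range_succ, add_assoc, tsub_add_cancel_of_le (hf n.le_succ), ih]

/-- Two measures that are squeezed between `h t • w` and `h s • w` on every interval `(s, t]`, with
`h` nonincreasing and `w` of bounded density, satisfy `ν₁ ≤ ν₂`: over a fine partition the gaps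
between the bounds telescope.  No continuity of `h` is needed. -/
lemma measure_le_of_squeeze {ν₁ ν₂ w : Measure ℝ} {h : ℝ → ℝ≥0∞} {a b C : ℝ} (hab : a ≤ b)
    (hC : 0 ≤ C) (h1 : ∀ r, h r ≤ 1) (hanti : AntitoneOn h (Icc a b))
    (hw : ∀ s t, a ≤ s → s ≤ t → t ≤ b → w (Ioc s t) ≤ ENNReal.ofReal (C * (t - s)))
    (hν₁ : ∀ s t, a ≤ s → s ≤ t → t ≤ b → ∀ B, MeasurableSet B → B ⊆ Ioc s t →
      ν₁ B ≤ h s * w B)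
    (hν₂ : ∀ s t, a ≤ s → s ≤ t → t ≤ b → ∀ B, MeasurableSet B → B ⊆ Ioc s t →
      h t * w B ≤ ν₂ B)
    {B : Set ℝ} (hB : MeasurableSet B) (hBs : B ⊆ Ioc a b) : ν₁ B ≤ ν₂ B := by
  have key : ∀ n : ℕ, ν₁ B ≤ ν₂ B + ENNReal.ofReal (C * (b - a) * (1 / ((n : ℝ) + 1))) := by
    intro n
    have hn : (0 : ℝ) < (n : ℝ) + 1 := by positivity
    let t : ℕ → ℝ := fun k => a + min (k * ((b - a) / (n + 1))) (b - a)
    have hba : 0 ≤ b - a := by linarith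
    have hq : 0 ≤ (b - a) / (n + 1) := by positivity
    have ht : Monotone t := fun k l hkl => by
      have : (k : ℝ) ≤ l := by exact_mod_cast hkl
      simp only [t]
      gcongr
    have hta : ∀ k, a ≤ t k := fun k => by
      have : 0 ≤ min (k * ((b - a) / (n + 1))) (b - a) := le_min (by positivity) hba
      simp only [t]; linarith
    have htb : ∀ k, t k ≤ b := fun k => by
      have := min_le_right (k * ((b - a) / (n + 1))) (b - a)
      simp only [t]; linarith
    have ht0 : t 0 = a := by simp [t, hba]
    have htn : t (n + 1) = b := by
      have : ((n + 1 : ℕ) : ℝ) * ((b - a) / (n + 1)) = b - a := by push_cast; field_simp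
      simp only [t, this, min_self]; ring
    have hstep : ∀ k, t (k + 1) - t k ≤ (b - a) / (n + 1) := fun k => by
      have h2 : min (((k + 1 : ℕ) : ℝ) * ((b - a) / (n + 1))) (b - a) ≤
          min (k * ((b - a) / (n + 1))) (b - a) + (b - a) / (n + 1) := by
        rw [← min_add_add_right]
        refine min_le_min (le_of_eq ?_) (by linarith)
        push_cast; ring
      simp only [t]; linarith
    have hdec : ∀ ν : Measure ℝ, ν B = ∑ k ∈ Finset.range (n + 1),
        ν (B ∩ Ioc (t k) (t (k + 1))) := fun ν => by
      rw [← measure_inter_Ioc_eq_sum ν hB ht, ht0, htn, inter_eq_left.2 hBs]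
    have hmB : ∀ k, MeasurableSet (B ∩ Ioc (t k) (t (k + 1))) := fun k =>
      hB.inter measurableSet_Ioc
    set δ : ℝ≥0∞ := ENNReal.ofReal (C * (b - a) * (1 / ((n : ℝ) + 1))) with hδ
    have hwk : ∀ k, w (B ∩ Ioc (t k) (t (k + 1))) ≤ δ := fun k => by
      refine (measure_mono inter_subset_right).trans
        ((hw _ _ (hta k) (ht k.le_succ) (htb _)).trans (ENNReal.ofReal_le_ofReal ?_))
      calc C * (t (k + 1) - t k) ≤ C * ((b - a) / (n + 1)) := by gcongr; exact hstep k
        _ = _ := by ring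
    have hanti' : Antitone fun k => h (t k) := fun k l hkl =>
      hanti ⟨hta k, htb k⟩ ⟨hta l, htb l⟩ (ht hkl)
    rw [hdec ν₁, hdec ν₂]
    calc ∑ k ∈ Finset.range (n + 1), ν₁ (B ∩ Ioc (t k) (t (k + 1)))
        ≤ ∑ k ∈ Finset.range (n + 1), (ν₂ (B ∩ Ioc (t k) (t (k + 1))) +
            (h (t k) - h (t (k + 1))) * δ) := by
          refine Finset.sum_le_sum fun k _ => ?_
          calc ν₁ (B ∩ Ioc (t k) (t (k + 1)))
              ≤ h (t k) * w (B ∩ Ioc (t k) (t (k + 1))) :=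
                hν₁ _ _ (hta k) (ht k.le_succ) (htb _) _ (hmB k) inter_subset_right
            _ = h (t (k + 1)) * w (B ∩ Ioc (t k) (t (k + 1))) +
                (h (t k) - h (t (k + 1))) * w (B ∩ Ioc (t k) (t (k + 1))) := by
                rw [← add_mul, add_tsub_cancel_of_le (hanti' k.le_succ)]
            _ ≤ _ := by
                gcongr
                · exact hν₂ _ _ (hta k) (ht k.le_succ) (htb _) _ (hmB k) inter_subset_right
                · exact hwk k
      _ = ∑ k ∈ Finset.range (n + 1), ν₂ (B ∩ Ioc (t k) (t (k + 1))) +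
            (∑ k ∈ Finset.range (n + 1), (h (t k) - h (t (k + 1)))) * δ := by
          rw [Finset.sum_add_distrib, Finset.sum_mul]
      _ ≤ _ := by
          gcongr
          refine mul_le_of_le_one_left' ?_
          exact (le_self_add.trans (sum_tsub_succ_add_eq hanti' (n + 1)).le).trans (h1 _)
  refine ge_of_tendsto' (x := Filter.atTop) ?_ key
  have h0 := (ENNReal.continuous_ofReal.tendsto _).comp
    ((tendsto_one_div_add_atTop_nhds_zero_nat (𝕜 := ℝ)).const_mul (C * (b - a)))
  have := h0.const_add (ν₂ B)
  simpa [Function.comp_def] using this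

/-! ### Polar coordinates in the plane -/

lemma lintegral_norm_plane (f : ℝ → ℝ≥0∞) (hf : Measurable f) :
    ∫⁻ x : Plane, f ‖x‖ = ∫⁻ r in Ioi (0 : ℝ), ENNReal.ofReal (2 * Real.pi * r) * f r := by
  have hdim : Module.finrank ℝ Plane = 2 := by simp
  have hball : (volume : Measure Plane) (Metric.ball 0 1) = ENNReal.ofReal Real.pi := by
    rw [EuclideanSpace.volume_ball_fin_two]
    simp [ENNReal.ofReal, Real.toNNReal_of_nonneg Real.pi_pos.le]
  have hpow : (Measure.volumeIoiPow 1).map (Subtype.val : Ioi (0 : ℝ) → ℝ) =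
      (volume.restrict (Ioi 0)).withDensity fun r => ENNReal.ofReal r := by
    ext s hs
    rw [Measure.map_apply measurable_subtype_coe hs, Measure.volumeIoiPow,
      withDensity_apply _ (measurable_subtype_coe hs), withDensity_apply _ hs,
      Measure.restrict_restrict hs,
      ← lintegral_indicator (hs.inter measurableSet_Ioi),
      ← lintegral_indicator (measurable_subtype_coe hs)]
    have := lintegral_subtype_comap (μ := volume) (measurableSet_Ioi (a := (0:ℝ)))
      (s.indicator fun r => ENNReal.ofReal r)
    simp only [pow_one]
    rw [inter_comm, ← indicator_indicator, lintegral_indicator measurableSet_Ioi, ← this]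
    rfl
  calc ∫⁻ x : Plane, f ‖x‖
      = ∫⁻ x : ({(0)}ᶜ : Set Plane), f ‖x.1‖ ∂(volume.comap
          (Subtype.val : ({(0)}ᶜ : Set Plane) → Plane)) := by
        rw [lintegral_subtype_comap (measurableSet_singleton _).compl fun x => f ‖x‖,
          restrict_compl_singleton]
    _ = ∫⁻ x, f x.2 ∂(volume : Measure Plane).toSphere.prod
          (.volumeIoiPow (Module.finrank ℝ Plane - 1)) := by
        have := (volume : Measure Plane).measurePreserving_homeomorphUnitSphereProd.lintegral_comp_emb
          (Homeomorph.measurableEmbedding _) (f ∘ Subtype.val ∘ Prod.snd)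
        simpa using this
    _ = _ := by
        rw [lintegral_prod _ (by fun_prop)]
        simp only [lintegral_const]
        rw [Measure.toSphere_apply_univ, hball, hdim, Nat.add_one_sub_one,
          ← lintegral_map (μ := Measure.volumeIoiPow 1) hf measurable_subtype_coe, hpow,
          lintegral_withDensity_eq_lintegral_mul _ ENNReal.measurable_ofReal hf, mul_comm,
          ← lintegral_const_mul _ (by fun_prop)]
        refine lintegral_congr fun r => ?_
        simp only [Pi.mul_apply]
        rw [ENNReal.ofReal_mul (by positivity), ENNReal.ofReal_mul (by norm_num)]
        simp [mul_assoc]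

lemma volume_norm_preimage {B : Set ℝ} (hB : MeasurableSet B) :
    volume {x : Plane | ‖x‖ ∈ B} = ∫⁻ r in B ∩ Ioi 0, ENNReal.ofReal (2 * Real.pi * r) := by
  have h := lintegral_norm_plane (B.indicator 1) (measurable_one.indicator hB)
  have h2 : (fun x : Plane => B.indicator (1 : ℝ → ℝ≥0∞) ‖x‖) =
      {x : Plane | ‖x‖ ∈ B}.indicator 1 := rfl
  rw [h2, lintegral_indicator_one
    (show MeasurableSet {x : Plane | ‖x‖ ∈ B} from measurable_norm hB)] at h
  rw [h, ← Measure.restrict_restrict hB, ← lintegral_indicator hB]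
  refine lintegral_congr fun r => ?_
  by_cases hr : r ∈ B <;> simp [hr]

/-! ### The Mecke formula for the distances to the origin -/

namespace IsHPPP

variable {Ω : Type*} {X : ℕ → Ω → Plane} [MeasurableSpace Ω] {μ : Measure Ω} {lam : ℝ}

/-- The Mecke formula for the distances to the origin, with a weight depending on the distance of
the selected point and a product functional of the others that does not. -/
lemma mecke_norm_weight (hX : IsHPPP μ lam X) [IsProbabilityMeasure μ] (hlam : 0 ≤ lam)
    {K : Plane → ℝ≥0∞} (hKm : Measurable K) (hK1 : ∀ x, K x ≤ 1) {g : ℝ → ℝ≥0∞}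
    (hg : Measurable g) {s t : ℝ} (hs : 0 ≤ s) {B : Set ℝ} (hB : MeasurableSet B)
    (hBs : B ⊆ Ioc s t) :
    ∑' i, ∫⁻ ω in {ω | ‖X i ω‖ ∈ B},
        g ‖X i ω‖ * infProd (Function.update (fun j => K (X j ω)) i 1) ∂μ =
      expNeg (ENNReal.ofReal lam * ∫⁻ x, (1 - K x)) *
        ∫⁻ r in B, ENNReal.ofReal (2 * Real.pi * r * lam) * g r := by
  set e := expNeg (ENNReal.ofReal lam * ∫⁻ x, (1 - K x))
  let F : ℕ → Ω → ℝ≥0∞ := fun i ω => infProd (Function.update (fun j => K (X j ω)) i 1)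
  have hFm : ∀ i, Measurable (F i) := fun i => hX.measurable_infProd_update hKm i
  have hRm : ∀ i, Measurable fun ω => ‖X i ω‖ := fun i => (hX.measurable i).norm
  let ρ₁ : Measure ℝ := Measure.sum fun i => (μ.withDensity (F i)).map fun ω => ‖X i ω‖
  let ρ₂ : Measure ℝ := volume.withDensity fun r => e * ENNReal.ofReal (2 * Real.pi * r * lam)
  have hρ : ρ₁.restrict (Ioc s t) = ρ₂.restrict (Ioc s t) := by
    ext B' hB'
    rw [Measure.restrict_apply hB', Measure.restrict_apply hB']
    have hm : MeasurableSet (B' ∩ Ioc s t) := hB'.inter measurableSet_Ioc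
    set B'' := B' ∩ Ioc s t
    have hsub : {x : Plane | ‖x‖ ∈ B''} ⊆ Metric.closedBall 0 t := fun x hx =>
      mem_closedBall_zero_iff.2 hx.2.2
    have hv : volume {x : Plane | ‖x‖ ∈ B''} ≠ ∞ :=
      measure_ne_top_of_subset hsub measure_closedBall_lt_top.ne
    have h0 : B'' ∩ Ioi 0 = B'' := inter_eq_left.2 fun r hr => lt_of_le_of_lt hs hr.2.1
    simp only [ρ₁, ρ₂]
    rw [Measure.sum_apply _ hm, withDensity_apply _ hm, lintegral_const_mul _ (by fun_prop)]
    have h1 := hX.mecke (A := {x : Plane | ‖x‖ ∈ B''}) hlam hKm hK1 (measurable_norm hm) hv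
    rw [volume_norm_preimage hm, h0, ← lintegral_const_mul _ (by fun_prop)] at h1
    have h2 : ∀ i, ((μ.withDensity (F i)).map fun ω => ‖X i ω‖) B'' =
        ∫⁻ ω in X i ⁻¹' {x : Plane | ‖x‖ ∈ B''}, F i ω ∂μ := fun i => by
      rw [Measure.map_apply (hRm i) hm, withDensity_apply _ (hRm i hm)]
      rfl
    simp_rw [h2]
    rw [h1, mul_comm]
    congr 1
    refine lintegral_congr fun r => ?_
    rw [mul_comm, ENNReal.ofReal_mul' hlam]
  have hρB : ρ₁.restrict B = ρ₂.restrict B := by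
    rw [← inter_eq_left.2 hBs, ← Measure.restrict_restrict hB, hρ, Measure.restrict_restrict hB]
  have hl : ∫⁻ r in B, g r ∂ρ₁ = ∫⁻ r in B, g r ∂ρ₂ := by rw [hρB]
  have hgi : Measurable (B.indicator g) := hg.indicator hB
  rw [← lintegral_indicator hB, ← lintegral_indicator hB, lintegral_sum_measure,
    lintegral_withDensity_eq_lintegral_mul _ (by fun_prop) hgi] at hl
  rw [← lintegral_const_mul _ (by fun_prop), ← lintegral_indicator hB]
  refine Eq.trans (tsum_congr fun i => ?_) (hl.trans (lintegral_congr fun r => ?_))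
  · rw [lintegral_map hgi (hRm i), lintegral_withDensity_eq_lintegral_mul _ (hFm i)
      (show Measurable fun ω => B.indicator g ‖X i ω‖ from hgi.comp (hRm i)), ← lintegral_indicator
      (show MeasurableSet {ω | ‖X i ω‖ ∈ B} from hRm i hB)]
    refine lintegral_congr fun ω => ?_
    by_cases h : ‖X i ω‖ ∈ B
    · rw [indicator_of_mem (show ω ∈ {ω | ‖X i ω‖ ∈ B} from h)]
      simp [h, F, mul_comm]
    · rw [indicator_of_notMem (show ω ∉ {ω | ‖X i ω‖ ∈ B} from h)]
      simp [h]
  · by_cases h : r ∈ B <;> simp [h, mul_assoc]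

/-- The Mecke formula for the distances to the origin, with a functional of the remaining points
that depends monotonically on the distance of the selected point. -/
theorem mecke_radial (hX : IsHPPP μ lam X) [IsProbabilityMeasure μ] (hlam : 0 ≤ lam)
    {H : ℝ → Plane → ℝ≥0∞} (hHm : ∀ r, Measurable (H r)) (hH1 : ∀ r x, H r x ≤ 1)
    (hanti : ∀ x, AntitoneOn (fun r => H r x) (Ioi 0)) {g : ℝ → ℝ≥0∞}
    (hg : Measurable g) (hg1 : ∀ r, g r ≤ 1) {B : Set ℝ} (hB : MeasurableSet B)
    (hB0 : B ⊆ Ioi 0) :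
    ∑' i, ∫⁻ ω in {ω | ‖X i ω‖ ∈ B},
        g ‖X i ω‖ * infProd (Function.update (fun j => H ‖X i ω‖ (X j ω)) i 1) ∂μ =
      ∫⁻ r in B, ENNReal.ofReal (2 * Real.pi * r * lam) * g r *
        expNeg (ENNReal.ofReal lam * ∫⁻ x, (1 - H r x)) := by
  set h : ℝ → ℝ≥0∞ := fun r => expNeg (ENNReal.ofReal lam * ∫⁻ x, (1 - H r x))
  have hRm : ∀ i, Measurable fun ω => ‖X i ω‖ := fun i => (hX.measurable i).norm
  let F : ℕ → Ω → ℝ≥0∞ := fun i ω =>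
    g ‖X i ω‖ * infProd (Function.update (fun j => H ‖X i ω‖ (X j ω)) i 1)
  let ν₁ : Measure ℝ := Measure.sum fun i => (μ.withDensity (F i)).map fun ω => ‖X i ω‖
  let w : Measure ℝ := volume.withDensity fun r => ENNReal.ofReal (2 * Real.pi * r * lam) * g r
  let ν₂ : Measure ℝ := volume.withDensity fun r =>
    ENNReal.ofReal (2 * Real.pi * r * lam) * g r * h r
  have hν₁ : ∀ B, MeasurableSet B → ν₁ B = ∑' i, ∫⁻ ω in {ω | ‖X i ω‖ ∈ B}, F i ω ∂μ := by
    intro B hB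
    simp only [ν₁]
    rw [Measure.sum_apply _ hB]
    refine tsum_congr fun i => ?_
    rw [Measure.map_apply (hRm i) hB, withDensity_apply _ (hRm i hB)]
    rfl
  have hν₂ : ∀ B, MeasurableSet B → ν₂ B = ∫⁻ r in B,
      ENNReal.ofReal (2 * Real.pi * r * lam) * g r * h r := fun B hB => withDensity_apply _ hB
  have hwB : ∀ B, MeasurableSet B → w B = ∫⁻ r in B,
      ENNReal.ofReal (2 * Real.pi * r * lam) * g r := fun B hB => withDensity_apply _ hB
  have hh : AntitoneOn h (Ioi 0) := fun r hr r' hr' hrr' => antitone_expNeg <|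
    mul_le_mul_right (lintegral_mono fun x => tsub_le_tsub_left (hanti x hr hr' hrr') 1) _
  have hwm : Measurable fun r : ℝ => ENNReal.ofReal (2 * Real.pi * r * lam) * g r := by fun_prop
  -- the squeeze, on intervals bounded away from the origin
  have b₁ : ∀ s t, 0 < s → ∀ B, MeasurableSet B → B ⊆ Ioc s t →
      h t * w B ≤ ν₁ B ∧ ν₁ B ≤ h s * w B := by
    intro s t hs B hB hBs
    have e1 := hX.mecke_norm_weight hlam (hHm s) (hH1 s) hg hs.le hB hBs
    have e2 := hX.mecke_norm_weight hlam (hHm t) (hH1 t) hg hs.le hB hBs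
    rw [hwB B hB, hν₁ B hB, ← e1, ← e2]
    constructor <;> refine ENNReal.tsum_le_tsum fun i => ?_ <;>
      refine setLIntegral_mono' (hRm i hB) fun ω hω => ?_ <;>
      refine mul_le_mul_right (infProd_mono fun j => update_one_mono (fun j => ?_) i j) _
    · exact hanti _ (hs.trans (hBs hω).1) (hs.trans ((hBs hω).1.trans_le (hBs hω).2)) (hBs hω).2
    · exact hanti _ hs (hs.trans (hBs hω).1) (hBs hω).1.le
  have b₂ : ∀ s t, 0 < s → ∀ B, MeasurableSet B → B ⊆ Ioc s t →
      h t * w B ≤ ν₂ B ∧ ν₂ B ≤ h s * w B := by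
    intro s t hs B hB hBs
    rw [hwB B hB, hν₂ B hB, ← lintegral_const_mul _ hwm, ← lintegral_const_mul _ hwm]
    constructor <;> refine setLIntegral_mono' hB fun r hr => ?_ <;> rw [mul_comm] <;> gcongr
    · exact hh (hs.trans (hBs hr).1) (hs.trans ((hBs hr).1.trans_le (hBs hr).2)) (hBs hr).2
    · exact hh hs (hs.trans (hBs hr).1) (hBs hr).1.le
  have bw : ∀ b s t, 0 < s → s ≤ t → t ≤ b →
      w (Ioc s t) ≤ ENNReal.ofReal (2 * Real.pi * b * lam * (t - s)) := by
    intro b s t hs hst htb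
    have hb : 0 ≤ b := by linarith
    rw [hwB _ measurableSet_Ioc, ENNReal.ofReal_mul (by positivity), ← Real.volume_Ioc,
      ← setLIntegral_const]
    refine setLIntegral_mono' measurableSet_Ioc fun r hr => ?_
    refine (mul_le_of_le_one_right' (hg1 r)).trans (ENNReal.ofReal_le_ofReal ?_)
    have := hr.2.trans htb
    gcongr
  have hle : ∀ n : ℕ, ν₁.restrict (Ioc (1 / ((n : ℝ) + 1)) (n + 1)) =
      ν₂.restrict (Ioc (1 / ((n : ℝ) + 1)) (n + 1)) := by
    intro n
    have ha : (0 : ℝ) < 1 / ((n : ℝ) + 1) := by positivity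
    have hab : 1 / ((n : ℝ) + 1) ≤ n + 1 := by
      rw [div_le_iff₀ (by positivity)]
      have : (0 : ℝ) ≤ n := by positivity
      nlinarith
    ext B hB
    rw [Measure.restrict_apply hB, Measure.restrict_apply hB]
    have hm := hB.inter (measurableSet_Ioc (a := 1 / ((n : ℝ) + 1)) (b := (n : ℝ) + 1))
    have hC : (0 : ℝ) ≤ 2 * Real.pi * (n + 1) * lam := by positivity
    have hanti' : AntitoneOn h (Icc (1 / ((n : ℝ) + 1)) (n + 1)) :=
      hh.mono fun r hr => ha.trans_le hr.1
    refine le_antisymm ?_ ?_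
    · exact measure_le_of_squeeze (w := w) hab hC (fun r => expNeg_le_one _) hanti'
        (fun s t hs hst ht => bw _ s t (ha.trans_le hs) hst ht)
        (fun s t hs _ _ B hB hBs => (b₁ s t (ha.trans_le hs) B hB hBs).2)
        (fun s t hs _ _ B hB hBs => (b₂ s t (ha.trans_le hs) B hB hBs).1) hm inter_subset_right
    · exact measure_le_of_squeeze (w := w) hab hC (fun r => expNeg_le_one _) hanti'
        (fun s t hs hst ht => bw _ s t (ha.trans_le hs) hst ht)
        (fun s t hs _ _ B hB hBs => (b₂ s t (ha.trans_le hs) B hB hBs).2)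
        (fun s t hs _ _ B hB hBs => (b₁ s t (ha.trans_le hs) B hB hBs).1) hm inter_subset_right
  have hU : Ioi (0 : ℝ) ⊆ ⋃ n : ℕ, Ioc (1 / ((n : ℝ) + 1)) (n + 1) := by
    intro r hr
    obtain ⟨n, hn⟩ := exists_nat_one_div_lt (show (0 : ℝ) < r from hr)
    obtain ⟨m, hm⟩ := exists_nat_ge r
    refine mem_iUnion.2 ⟨max n m, ?_, ?_⟩
    · refine lt_of_le_of_lt ?_ hn
      have : (n : ℝ) ≤ (max n m : ℕ) := by exact_mod_cast le_max_left n m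
      gcongr
    · have : (m : ℝ) ≤ (max n m : ℕ) := by exact_mod_cast le_max_right n m
      linarith
  have hfin := Measure.restrict_iUnion_congr.2 hle
  have hB' : B ∩ ⋃ n : ℕ, Ioc (1 / ((n : ℝ) + 1)) (n + 1) = B :=
    inter_eq_left.2 (hB0.trans hU)
  rw [← hν₁ B hB, ← hν₂ B hB, ← hB', ← Measure.restrict_apply hB, hfin, Measure.restrict_apply hB]

end IsHPPP

namespace PathLossModel

variable {N : ℕ} {M : PathLossModel N}

/-! ### The stacked functions -/

lemma measurableSet_piece (n : Fin N) : MeasurableSet (M.piece n) :=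
  (measurableSet_lt measurable_const measurable_coe_real_ereal).inter
    (measurableSet_le measurable_coe_real_ereal measurable_const)

lemma measurable_stack {f : Fin N → ℝ → ℝ} (hf : ∀ n, Measurable ((M.piece n).indicator (f n))) :
    Measurable (M.stack f) := by
  unfold stack
  exact Finset.measurable_sum _ fun n _ => hf n

lemma measurable_zeta (p : LinkType) : Measurable (M.zeta p) := by
  refine measurable_stack fun n => Measurable.indicator ?_ (measurableSet_piece n)
  unfold zetaPiece
  fun_prop

namespace IsValid

variable (hM : M.IsValid)

include hM

lemma pos_of_mem_piece {n : Fin N} {r : ℝ} (hr : r ∈ M.piece n) : 0 < r := by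
  have h : (0 : EReal) ≤ M.d n.castSucc := hM.d_zero ▸ hM.d_strictMono.monotone (Fin.zero_le _)
  exact_mod_cast h.trans_lt hr.1

lemma exists_mem_piece {r : ℝ} (hr : 0 < r) : ∃ n, r ∈ M.piece n := by
  by_contra! h
  have : ∀ k : Fin (N + 1), M.d k < (r : EReal) := by
    intro k
    induction k using Fin.induction with
    | zero => rw [hM.d_zero]; exact_mod_cast hr
    | succ n ih => exact not_le.1 fun h' => h n ⟨ih, h'⟩
  exact not_top_lt (hM.d_last ▸ this (Fin.last N))

lemma eq_of_mem_piece {n m : Fin N} {r : ℝ} (hn : r ∈ M.piece n) (hm : r ∈ M.piece m) :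
    n = m := by
  have key : ∀ {n m : Fin N}, r ∈ M.piece n → r ∈ M.piece m → ¬ n < m := fun {n m} hn hm h =>
    absurd (hn.2.trans (hM.d_strictMono.monotone (Fin.succ_le_castSucc_iff.2 h)))
      (not_le.2 hm.1)
  exact le_antisymm (not_lt.1 (key hm hn)) (not_lt.1 (key hn hm))

lemma stack_eq {f : Fin N → ℝ → ℝ} {n : Fin N} {r : ℝ} (hr : r ∈ M.piece n) :
    M.stack f r = f n r := by
  rw [stack, Finset.sum_eq_single n, indicator_of_mem hr]
  · exact fun m _ hm => indicator_of_notMem (fun h => hm (hM.eq_of_mem_piece h hr)) _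
  · simp

lemma stack_of_nonpos {f : Fin N → ℝ → ℝ} {r : ℝ} (hr : r ≤ 0) : M.stack f r = 0 :=
  Finset.sum_eq_zero fun _ _ => indicator_of_notMem
    (fun h => absurd (hM.pos_of_mem_piece h) (not_lt.2 hr)) _

lemma zeta_eq (p : LinkType) {n : Fin N} {r : ℝ} (hr : r ∈ M.piece n) :
    M.zeta p r = M.zetaPiece p n r := hM.stack_eq hr

lemma linkProb_eq (p : LinkType) {n : Fin N} {r : ℝ} (hr : r ∈ M.piece n) :
    M.linkProb p r = M.linkProbPiece p n r := hM.stack_eq hr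

lemma linkProb_mem_Icc (p : LinkType) (r : ℝ) : M.linkProb p r ∈ Icc (0 : ℝ) 1 := by
  by_cases hr : 0 < r
  · obtain ⟨n, hn⟩ := hM.exists_mem_piece hr
    rw [hM.linkProb_eq p hn]
    obtain ⟨h0, h1⟩ := hM.prLoS_mem n r hn
    cases p
    · exact ⟨h0, h1⟩
    · exact ⟨sub_nonneg.2 h1, sub_le_self 1 h0⟩
  · rw [linkProb, hM.stack_of_nonpos (not_lt.1 hr)]
    simp

lemma linkProb_nlos {r : ℝ} (hr : 0 < r) : M.linkProb .nlos r = 1 - M.linkProb .los r := by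
  obtain ⟨n, hn⟩ := hM.exists_mem_piece hr
  rw [hM.linkProb_eq _ hn, hM.linkProb_eq _ hn]
  rfl

lemma measurable_linkProb (p : LinkType) : Measurable (M.linkProb p) := by
  refine measurable_stack fun n => ?_
  obtain ⟨g, hg, hfg⟩ := (hM.prLoS_antitone n).exists_antitone_extension
    ⟨0, forall_mem_image.2 fun r hr => (hM.prLoS_mem n r hr).1⟩
    ⟨1, forall_mem_image.2 fun r hr => (hM.prLoS_mem n r hr).2⟩
  cases p
  · have : (M.piece n).indicator (M.linkProbPiece .los n) = (M.piece n).indicator g :=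
      indicator_congr hfg
    rw [this]
    exact hg.measurable.indicator (measurableSet_piece n)
  · have : (M.piece n).indicator (M.linkProbPiece .nlos n) =
        (M.piece n).indicator fun r => 1 - g r :=
      indicator_congr fun r hr => by simp only [linkProbPiece, hfg hr]
    rw [this]
    exact (hg.measurable.const_sub 1).indicator (measurableSet_piece n)

lemma zeta_pos (p : LinkType) {r : ℝ} (hr : 0 < r) : 0 < M.zeta p r := by
  obtain ⟨n, hn⟩ := hM.exists_mem_piece hr
  rw [hM.zeta_eq p hn]
  exact mul_pos (hM.A_pos p n) (Real.rpow_pos_of_pos hr _)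

lemma zeta_of_nonpos (p : LinkType) {r : ℝ} (hr : r ≤ 0) : M.zeta p r = 0 := hM.stack_of_nonpos hr

lemma zeta_nonneg (p : LinkType) (r : ℝ) : 0 ≤ M.zeta p r := by
  rcases lt_or_ge 0 r with h | h
  · exact (hM.zeta_pos p h).le
  · rw [hM.zeta_of_nonpos p h]

lemma zeta_strictAntiOn (p : LinkType) : StrictAntiOn (M.zeta p) (Ioi 0) := by
  intro r hr r' hr' hrr'
  obtain ⟨n, hn⟩ := hM.exists_mem_piece hr'
  -- strictness comes from a point to the left of `r'` in the piece of `r'`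
  obtain ⟨x, hx1, hx2⟩ := EReal.lt_iff_exists_real_btwn.1
    (max_lt hn.1 (EReal.coe_lt_coe_iff.2 hrr'))
  have hxr : r < x := EReal.coe_lt_coe_iff.1 ((le_max_right _ _).trans_lt hx1)
  have hx0 : 0 < x := lt_trans hr hxr
  have hxn : x ∈ M.piece n := ⟨(le_max_left _ _).trans_lt hx1, hx2.le.trans hn.2⟩
  refine lt_of_lt_of_le ?_ (hM.zeta_antitone p hr hx0 hxr.le)
  rw [hM.zeta_eq p hn, hM.zeta_eq p hxn]
  exact mul_lt_mul_of_pos_left (Real.rpow_lt_rpow_of_neg hx0 (EReal.coe_lt_coe_iff.1 hx2)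
    (neg_lt_zero.2 (hM.α_pos p n))) (hM.A_pos p n)

lemma exists_zeta_lt (p : LinkType) {y : ℝ} (hy : 0 < y) : ∃ x, 0 < x ∧ M.zeta p x < y := by
  have hN : N ≠ 0 := by
    rintro rfl
    have h := hM.d_zero.symm.trans hM.d_last
    exact absurd h (by simp)
  obtain ⟨k, rfl⟩ := Nat.exists_eq_succ_of_ne_zero hN
  let n := Fin.last k
  have hlt : M.d n.castSucc < ⊤ := by
    rw [← hM.d_last]
    exact hM.d_strictMono (Fin.castSucc_lt_last n)
  obtain ⟨c, hc, -⟩ := EReal.lt_iff_exists_real_btwn.1 hlt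
  have ht : Filter.Tendsto (M.zetaPiece p n) Filter.atTop (nhds 0) := by
    have := (tendsto_rpow_neg_atTop (hM.α_pos p n)).const_mul (M.A p n)
    rwa [mul_zero] at this
  obtain ⟨x, hx, hcx⟩ := ((ht.eventually_lt_const hy).and (Filter.eventually_gt_atTop c)).exists
  have hxn : x ∈ M.piece n := by
    refine ⟨hc.trans (EReal.coe_lt_coe_iff.2 hcx), ?_⟩
    have : n.succ = Fin.last (k + 1) := rfl
    rw [this, hM.d_last]
    exact le_top
  exact ⟨x, hM.pos_of_mem_piece hxn, by rwa [hM.zeta_eq p hxn]⟩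

lemma exists_le_zeta (p : LinkType) (y : ℝ) : ∃ x, 0 < x ∧ y ≤ M.zeta p x := by
  obtain ⟨n, hn⟩ := hM.exists_mem_piece one_pos
  have hN : 0 < N := n.pos
  let m : Fin N := ⟨0, hN⟩
  have hm0 : M.d m.castSucc = 0 := hM.d_zero
  have hpos : 0 < M.d m.succ := by
    rw [← hm0]; exact hM.d_strictMono (Fin.castSucc_lt_succ)
  obtain ⟨c, hc0, hc⟩ := EReal.lt_iff_exists_real_btwn.1 hpos
  have hc0' : 0 < c := by exact_mod_cast hc0
  have ht : Filter.Tendsto (M.zetaPiece p m) (nhdsWithin 0 (Ioi 0)) Filter.atTop :=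
    (tendsto_rpow_neg_nhdsGT_zero (neg_lt_zero.2 (hM.α_pos p m))).const_mul_atTop (hM.A_pos p m)
  obtain ⟨x, hx, hx0, hxc⟩ := ((ht.eventually_ge_atTop y).and
    (Ioo_mem_nhdsGT hc0')).exists
  have hxm : x ∈ M.piece m := by
    refine ⟨?_, (EReal.coe_lt_coe_iff.2 hxc).le.trans hc.le⟩
    rw [hm0]; exact_mod_cast hx0
  exact ⟨x, hx0, by rwa [hM.zeta_eq p hxm]⟩

end IsValid

/-! ### The generalized inverse of the path loss -/

/-- The largest distance at which a link of type `q` has path loss at least `y`, as a supremum. -/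
noncomputable def zetaInv (M : PathLossModel N) (q : LinkType) (y : ℝ) : ℝ :=
  sSup {x : ℝ | 0 < x ∧ y ≤ M.zeta q x}

namespace IsValid

variable (hM : M.IsValid)

include hM

lemma bddAbove_setOf_le_zeta (q : LinkType) {y : ℝ} (hy : 0 < y) :
    BddAbove {x : ℝ | 0 < x ∧ y ≤ M.zeta q x} := by
  obtain ⟨b, hb, hby⟩ := hM.exists_zeta_lt q hy
  refine ⟨b, fun x hx => le_of_not_gt fun hbx => ?_⟩
  exact absurd (hM.zeta_strictAntiOn q hb hx.1 hbx) (not_lt.2 (hby.le.trans hx.2))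

lemma zetaInv_pos (q : LinkType) {y : ℝ} (hy : 0 < y) : 0 < M.zetaInv q y := by
  obtain ⟨x, hx, hxy⟩ := hM.exists_le_zeta q y
  exact hx.trans_le (le_csSup (hM.bddAbove_setOf_le_zeta q hy) ⟨hx, hxy⟩)

lemma zeta_lt_of_zetaInv_lt (q : LinkType) {x y : ℝ} (hy : 0 < y) (hx : M.zetaInv q y < x) :
    M.zeta q x < y := by
  by_contra! h
  exact absurd (le_csSup (hM.bddAbove_setOf_le_zeta q hy)
    ⟨(hM.zetaInv_pos q hy).trans hx, h⟩) (not_le.2 hx)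

lemma lt_zeta_of_lt_zetaInv (q : LinkType) {x y : ℝ} (hx0 : 0 < x)
    (hx : x < M.zetaInv q y) : y < M.zeta q x := by
  obtain ⟨z, hz⟩ := hM.exists_le_zeta q y
  obtain ⟨b, ⟨hb0, hb⟩, hxb⟩ := exists_lt_of_lt_csSup ⟨z, hz⟩ hx
  exact hb.trans_lt (hM.zeta_strictAntiOn q hx0 hb0 hxb)

lemma zetaInv_eq_of_zeta_eq (q : LinkType) {x y : ℝ} (hx : 0 < x) (h : M.zeta q x = y) :
    M.zetaInv q y = x := by
  have hy : 0 < y := h ▸ hM.zeta_pos q hx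
  refine le_antisymm (le_of_not_gt fun hlt => ?_)
    (le_csSup (hM.bddAbove_setOf_le_zeta q hy) ⟨hx, h.ge⟩)
  exact absurd (hM.lt_zeta_of_lt_zetaInv q hx hlt) h.le.not_gt

lemma zeta_zetaInv (q : LinkType) {y : ℝ} (hy : 0 < y) (hc : ContinuousOn (M.zeta q) (Ioi 0)) :
    M.zeta q (M.zetaInv q y) = y := by
  obtain ⟨b, hb, hby⟩ := hM.exists_zeta_lt q hy
  obtain ⟨a, ha, hay⟩ := hM.exists_le_zeta q y
  have hab : a ≤ b := le_of_not_gt fun hba =>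
    absurd (hM.zeta_strictAntiOn q hb ha hba) (not_lt.2 (hby.le.trans hay))
  obtain ⟨x, hx, hxy⟩ := intermediate_value_Icc' hab
    (hc.mono fun z hz => ha.trans_le hz.1) ⟨hby.le, hay⟩
  rw [hM.zetaInv_eq_of_zeta_eq q (ha.trans_le hx.1) hxy, hxy]

end IsValid

end PathLossModel

/-! ### The exponential distribution -/

lemma expMeasure_one_eq : expMeasure 1 = volume.withDensity (exponentialPDF 1) := rfl

lemma measurable_exponentialPDF (r : ℝ) : Measurable (exponentialPDF r) :=
  (measurable_exponentialPDFReal r).ennreal_ofReal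

/-- The Laplace transform of the exponential distribution. -/
lemma lintegral_expNeg_mul_expMeasure {c : ℝ} (hc : 0 ≤ c) :
    ∫⁻ g, expNeg (ENNReal.ofReal (c * g)) ∂(expMeasure 1) = ENNReal.ofReal (1 / (1 + c)) := by
  rw [expMeasure_one_eq, lintegral_withDensity_eq_lintegral_mul _ (measurable_exponentialPDF 1)
    (by fun_prop)]
  have h : ∀ x, (exponentialPDF 1 * fun g => expNeg (ENNReal.ofReal (c * g))) x =
      ENNReal.ofReal (1 / (1 + c)) * exponentialPDF (1 + c) x := by
    intro x
    simp only [Pi.mul_apply]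
    rcases lt_or_ge x 0 with hx | hx
    · rw [exponentialPDF_of_neg hx, exponentialPDF_of_neg hx]; simp
    · rw [exponentialPDF_of_nonneg hx, exponentialPDF_of_nonneg hx, expNeg_ofReal (by positivity),
        ← ENNReal.ofReal_mul (by positivity), ← ENNReal.ofReal_mul (by positivity)]
      congr 1
      rw [one_mul, ← Real.exp_add]
      have : 1 + c ≠ 0 := by positivity
      field_simp
      congr 1; ring
  simp_rw [h]
  rw [lintegral_const_mul _ (measurable_exponentialPDF _),
    lintegral_exponentialPDF_eq_one (by positivity), mul_one]

/-- The tail of the exponential distribution, which turns an outage probability into a Laplace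
transform of the interference. -/
lemma expMeasure_lt_ofReal_mul (v : ℝ≥0∞) {c : ℝ} (hc : 0 < c) :
    expMeasure 1 {g | v < ENNReal.ofReal (c * g)} = expNeg (v / ENNReal.ofReal c) := by
  have : IsProbabilityMeasure (expMeasure 1) := isProbabilityMeasure_expMeasure one_pos
  induction v with
  | top => simp [ENNReal.top_div]
  | coe t =>
    have h1 : {g : ℝ | (t : ℝ≥0∞) < ENNReal.ofReal (c * g)} = (Iic ((t : ℝ) / c))ᶜ := by
      ext g
      rw [compl_Iic, mem_Ioi, mem_ofPred_eq, ← ENNReal.ofReal_coe_nnreal,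
        ENNReal.ofReal_lt_ofReal_iff_of_nonneg (by positivity), div_lt_iff₀' hc]
    have ht : (0 : ℝ) ≤ t / c := by positivity
    rw [h1, ← ofReal_measureReal, measureReal_compl measurableSet_Iic, ← cdf_eq_real,
      cdf_expMeasure_eq one_pos, if_pos ht, ← ENNReal.ofReal_coe_nnreal,
      ← ENNReal.ofReal_div_of_pos hc, expNeg_ofReal ht]
    simp

/-! ### Averaging over the attributes of one base station -/

namespace PathLossModel

variable {N : ℕ} (M : PathLossModel N)

open Classical in
/-- The type of a link of length `u` with link mark `m`. -/
noncomputable def linkTypeAt (u m : ℝ) : LinkType :=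
  if m ≤ M.linkProb .los u then .los else .nlos

/-- The path loss of a link of length `u` with link mark `m`. -/
noncomputable def pathLossAt (u m : ℝ) : ℝ := M.zeta (M.linkTypeAt u m) u

/-- The factor contributed by a base station at distance `u` with attributes `e` to the product
over all base stations: the indicator that its path loss `β` satisfies `R β y`, times `exp (-s I)`
where `I` is the interference that it generates.  The relation `R` is `≤` or `<`. -/
noncomputable def linkFactor (P : ℝ) (R : ℝ → ℝ → Prop) (y s u : ℝ) (e : ℝ × Bool × ℝ) : ℝ≥0∞ :=
  {b | R b y}.indicator 1 (M.pathLossAt u e.1) *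
    if e.2.1 = true then
      expNeg (ENNReal.ofReal s * ENNReal.ofReal (P * M.pathLossAt u e.1 * e.2.2)) else 1

/-- The expectation of `linkFactor` over the attributes. -/
noncomputable def meanFactor (lam lamA P : ℝ) (R : ℝ → ℝ → Prop) (y s u : ℝ) : ℝ≥0∞ :=
  ∫⁻ e, M.linkFactor P R y s u e ∂(attributeLaw lam lamA)

variable {M}

lemma linkFactor_le_one (P : ℝ) (R : ℝ → ℝ → Prop) (y s u : ℝ) (e : ℝ × Bool × ℝ) :
    M.linkFactor P R y s u e ≤ 1 := by
  unfold linkFactor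
  refine mul_le_one' (indicator_le_self' (fun _ _ => zero_le) _) ?_
  · split_ifs
    · exact expNeg_le_one _
    · exact le_rfl

end PathLossModel

instance isProbabilityMeasure_expMeasure_one : IsProbabilityMeasure (expMeasure 1) :=
  isProbabilityMeasure_expMeasure one_pos

lemma lintegral_attributeLaw (lam lamA : ℝ) {F : ℝ × Bool × ℝ → ℝ≥0∞} (hF : Measurable F) :
    ∫⁻ e, F e ∂(attributeLaw lam lamA) = ∫⁻ m in Icc (0 : ℝ) 1,
      (ENNReal.ofReal (lamA / lam) * ∫⁻ g, F (m, true, g) ∂(expMeasure 1) +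
        ENNReal.ofReal (1 - lamA / lam) * ∫⁻ g, F (m, false, g) ∂(expMeasure 1)) := by
  rw [attributeLaw, lintegral_prod _ hF.aemeasurable]
  refine lintegral_congr fun m => ?_
  have hm : Measurable fun p : Bool × ℝ => F (m, p) := hF.comp measurable_prodMk_left
  rw [lintegral_prod _ hm.aemeasurable, lintegral_add_measure, lintegral_smul_measure,
    lintegral_smul_measure, lintegral_dirac, lintegral_dirac]
  rfl

lemma isProbabilityMeasure_attributeLaw {lam lamA : ℝ} (hlam : 0 < lam) (hlamA : 0 ≤ lamA)
    (hle : lamA ≤ lam) : IsProbabilityMeasure (attributeLaw lam lamA) := by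
  constructor
  have h := lintegral_attributeLaw lam lamA (F := fun _ => 1) measurable_const
  simp only [lintegral_const, measure_univ, mul_one, one_mul, Measure.restrict_apply_univ,
    Real.volume_Icc, sub_zero, ENNReal.ofReal_one] at h
  rw [h, ← ENNReal.ofReal_add (by positivity) (sub_nonneg.2 (div_le_one_of_le₀ hle hlam.le))]
  simp

namespace PathLossModel

variable {N : ℕ} {M : PathLossModel N}

namespace IsValid

variable (hM : M.IsValid)

include hM

/-- A uniform mark selects each link type with its probability. -/
lemma lintegral_linkTypeAt {u : ℝ} (hu : 0 < u) (G : LinkType → ℝ≥0∞) :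
    ∫⁻ m in Icc (0 : ℝ) 1, G (M.linkTypeAt u m) =
      ENNReal.ofReal (M.linkProb .los u) * G .los +
        ENNReal.ofReal (M.linkProb .nlos u) * G .nlos := by
  obtain ⟨h0, h1⟩ := hM.linkProb_mem_Icc .los u
  set c := M.linkProb .los u with hc
  have hU : Icc (0 : ℝ) 1 = Icc 0 c ∪ Ioc c 1 := (Icc_union_Ioc_eq_Icc h0 h1).symm
  have hd : Disjoint (Icc (0 : ℝ) c) (Ioc c 1) :=
    Set.disjoint_left.2 fun x hx hx' => absurd hx.2 (not_le.2 hx'.1)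
  rw [hU, lintegral_union measurableSet_Ioc hd]
  congr 1
  · rw [setLIntegral_congr_fun (g := fun _ => G .los) measurableSet_Icc fun m hm => by
      simp only [linkTypeAt]; rw [if_pos hm.2], setLIntegral_const, Real.volume_Icc, sub_zero,
      mul_comm]
  · rw [setLIntegral_congr_fun (g := fun _ => G .nlos) measurableSet_Ioc fun m hm => by
      simp only [linkTypeAt]; rw [if_neg (not_le.2 hm.1)], setLIntegral_const, Real.volume_Ioc,
      mul_comm, hM.linkProb_nlos hu]

lemma measurableSet_linkTypeAt : MeasurableSet {x : ℝ × ℝ | x.2 ≤ M.linkProb .los x.1} :=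
  measurableSet_le measurable_snd ((hM.measurable_linkProb .los).comp measurable_fst)

lemma measurable_comp_linkTypeAt {β : Type*} [MeasurableSpace β] {G : LinkType → ℝ → β}
    (hG : ∀ q, Measurable (G q)) :
    Measurable fun x : ℝ × ℝ => G (M.linkTypeAt x.1 x.2) x.1 := by
  have : (fun x : ℝ × ℝ => G (M.linkTypeAt x.1 x.2) x.1) = fun x =>
      haveI := Classical.propDecidable
      if x ∈ {x : ℝ × ℝ | x.2 ≤ M.linkProb .los x.1} then G .los x.1 else G .nlos x.1 := by
    funext x
    simp only [linkTypeAt, mem_ofPred_eq]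
    split_ifs <;> rfl
  rw [this]
  exact Measurable.ite hM.measurableSet_linkTypeAt ((hG _).comp measurable_fst)
    ((hG _).comp measurable_fst)

lemma measurable_pathLossAt : Measurable fun x : ℝ × ℝ => M.pathLossAt x.1 x.2 :=
  hM.measurable_comp_linkTypeAt fun q => measurable_zeta q

lemma measurable_linkFactor {P : ℝ} {R : ℝ → ℝ → Prop}
    (hR : MeasurableSet {x : ℝ × ℝ | R x.1 x.2}) {α : Type*} [MeasurableSpace α]
    {y s u : α → ℝ} {e : α → ℝ × Bool × ℝ} (hy : Measurable y) (hs : Measurable s)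
    (hu : Measurable u) (he : Measurable e) :
    Measurable fun a => M.linkFactor P R (y a) (s a) (u a) (e a) := by
  have hβ : Measurable fun a => M.pathLossAt (u a) (e a).1 :=
    hM.measurable_pathLossAt.comp (hu.prodMk he.fst)
  unfold linkFactor
  refine Measurable.mul ?_ ?_
  · exact measurable_one.indicator ((hβ.prodMk hy) hR)
  · refine Measurable.ite (he.snd.fst (measurableSet_singleton true)) ?_ measurable_const
    have := he.snd.snd
    fun_prop

/-- The probability that a base station at distance `u` has a link of type `p` and received power
above `v`. -/
lemma attributeLaw_linkTypeAt_gain {lam lamA P : ℝ} (hlam : 0 < lam) (hlamA : 0 ≤ lamA)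
    (hle : lamA ≤ lam) (hP : 0 < P) (p : LinkType) {u : ℝ} (hu : 0 < u) (v : ℝ≥0∞) :
    attributeLaw lam lamA {e | M.linkTypeAt u e.1 = p ∧
        v < ENNReal.ofReal (P * M.zeta p u * e.2.2)} =
      ENNReal.ofReal (M.linkProb p u) * expNeg (v / ENNReal.ofReal (P * M.zeta p u)) := by
  classical
  have hms : MeasurableSet {m : ℝ | M.linkTypeAt u m = p} := by
    have h1 : Measurable fun m : ℝ => (M.linkTypeAt u m = p : Prop) :=
      (hM.measurable_comp_linkTypeAt (G := fun q _ => (q = p : Prop))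
        (fun q => measurable_const)).comp (measurable_const.prodMk measurable_id)
    exact measurableSet_setOfPred.2 h1
  have hme : MeasurableSet {e : ℝ × Bool × ℝ | M.linkTypeAt u e.1 = p ∧
      v < ENNReal.ofReal (P * M.zeta p u * e.2.2)} :=
    (measurable_fst hms).inter (measurableSet_lt (f := fun _ => v) measurable_const
      (g := fun e : ℝ × Bool × ℝ => ENNReal.ofReal (P * M.zeta p u * e.2.2)) (by fun_prop))
  rw [← lintegral_indicator_one hme, lintegral_attributeLaw _ _ (measurable_one.indicator hme)]
  set E := expNeg (v / ENNReal.ofReal (P * M.zeta p u))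
  have hz : 0 < P * M.zeta p u := mul_pos hP (hM.zeta_pos p hu)
  have hmg : MeasurableSet {g : ℝ | v < ENNReal.ofReal (P * M.zeta p u * g)} :=
    measurableSet_lt (f := fun _ => v) measurable_const
      (g := fun g : ℝ => ENNReal.ofReal (P * M.zeta p u * g)) (by fun_prop)
  have hg : ∀ (m : ℝ) (b : Bool), ∫⁻ g, {e : ℝ × Bool × ℝ | M.linkTypeAt u e.1 = p ∧
      v < ENNReal.ofReal (P * M.zeta p u * e.2.2)}.indicator 1 (m, b, g) ∂(expMeasure 1) =
      if M.linkTypeAt u m = p then E else 0 := by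
    intro m b
    by_cases h : M.linkTypeAt u m = p
    · simp only [if_pos h, E]
      rw [← expMeasure_lt_ofReal_mul v hz, ← lintegral_indicator_one hmg]
      refine lintegral_congr fun g => ?_
      simp [indicator_apply, h]
    · simp [h]
  have hκ : ENNReal.ofReal (lamA / lam) + ENNReal.ofReal (1 - lamA / lam) = 1 := by
    rw [← ENNReal.ofReal_add (by positivity) (sub_nonneg.2 (div_le_one_of_le₀ hle hlam.le))]
    simp
  simp only [hg, ← add_mul, hκ, one_mul]
  rw [hM.lintegral_linkTypeAt hu fun q => if q = p then E else 0]
  cases p <;> simp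

/-- The integrand `1 - H` of the Mecke formula, split by link type: a base station violating the
threshold contributes `1`, and a weaker one the deficit of its exponential factor. -/
lemma one_sub_meanFactor {lam lamA P s : ℝ} (hlam : 0 < lam) (hlamA : 0 ≤ lamA) (hle : lamA ≤ lam)
    (hP : 0 < P) (hs : 0 ≤ s) {R : ℝ → ℝ → Prop} (hR : MeasurableSet {x : ℝ × ℝ | R x.1 x.2})
    (y : ℝ) {u : ℝ} (hu : 0 < u) (G : LinkType → ℝ≥0∞)
    (hG : ∀ q, R (M.zeta q u) y →
      G q = ENNReal.ofReal (lamA / lam * (s * P * M.zeta q u / (1 + s * P * M.zeta q u))))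
    (hG' : ∀ q, ¬ R (M.zeta q u) y → G q = 1) :
    1 - M.meanFactor lam lamA P R y s u =
      ENNReal.ofReal (M.linkProb .los u) * G .los +
        ENNReal.ofReal (M.linkProb .nlos u) * G .nlos := by
  classical
  set κ := lamA / lam with hκ
  have hκ0 : 0 ≤ κ := by positivity
  have hκ1 : κ ≤ 1 := div_le_one_of_le₀ hle hlam.le
  let G' : LinkType → ℝ≥0∞ := fun q => {b | R b y}.indicator 1 (M.zeta q u) *
    (ENNReal.ofReal κ * ENNReal.ofReal (1 / (1 + s * P * M.zeta q u)) + ENNReal.ofReal (1 - κ))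
  have hmean : M.meanFactor lam lamA P R y s u = ENNReal.ofReal (M.linkProb .los u) * G' .los +
        ENNReal.ofReal (M.linkProb .nlos u) * G' .nlos := by
    rw [← hM.lintegral_linkTypeAt hu, meanFactor, lintegral_attributeLaw _ _
      (hM.measurable_linkFactor (y := fun _ => y) (s := fun _ => s) (u := fun _ => u)
        (e := fun e => e) hR measurable_const measurable_const measurable_const measurable_id)]
    refine lintegral_congr fun m => ?_
    have hz := hM.zeta_nonneg (M.linkTypeAt u m) u
    have hb : ∀ g : ℝ, ENNReal.ofReal s * ENNReal.ofReal (P * M.zeta (M.linkTypeAt u m) u * g) =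
        ENNReal.ofReal (s * P * M.zeta (M.linkTypeAt u m) u * g) := fun g => by
      rw [← ENNReal.ofReal_mul hs]; congr 1; ring
    simp only [linkFactor, pathLossAt, if_true, hb, Bool.false_eq_true, if_false, mul_one,
      lintegral_const, measure_univ]
    rw [lintegral_const_mul _ (by fun_prop), lintegral_expNeg_mul_expMeasure (by positivity)]
    simp only [G']
    ring
  have hsum : ∀ q, G' q + G q = 1 := by
    intro q
    have hz := hM.zeta_nonneg q u
    by_cases h : R (M.zeta q u) y
    · have h1 : 0 ≤ s * P * M.zeta q u := by positivity
      simp only [G', indicator_of_mem (show M.zeta q u ∈ {b | R b y} from h), Pi.one_apply, one_mul,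
        hG q h]
      rw [← ENNReal.ofReal_mul hκ0, ← ENNReal.ofReal_add (by positivity) (by linarith),
        ← ENNReal.ofReal_add (add_nonneg (by positivity) (by linarith)) (by positivity),
        ENNReal.ofReal_eq_one]
      field_simp
      ring
    · simp [G', h, hG' q h]
  have hp : ENNReal.ofReal (M.linkProb .los u) + ENNReal.ofReal (M.linkProb .nlos u) = 1 := by
    rw [← ENNReal.ofReal_add (hM.linkProb_mem_Icc _ _).1 (hM.linkProb_mem_Icc _ _).1,
      hM.linkProb_nlos hu]
    simp
  have htot : M.meanFactor lam lamA P R y s u + (ENNReal.ofReal (M.linkProb .los u) * G .los +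
        ENNReal.ofReal (M.linkProb .nlos u) * G .nlos) = 1 := by
    rw [hmean, add_add_add_comm, ← mul_add, ← mul_add, hsum, hsum, mul_one, mul_one, hp]
  have hfin : M.meanFactor lam lamA P R y s u ≠ ∞ := ne_top_of_le_ne_top ENNReal.one_ne_top
    (htot ▸ le_self_add)
  exact ENNReal.sub_eq_of_eq_add_rev hfin htot.symm

end IsValid

/-! ### Evaluation of the product functional -/

/-- The exponent of the Laplace transform at `s` of the interference from the base stations of
link type `q` at distance more than `c`. -/
noncomputable def interferenceExponent (M : PathLossModel N) (lam lamA P s : ℝ) (q : LinkType)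
    (c : ℝ) : ℝ≥0∞ :=
  ∫⁻ u in Ioi c, ENNReal.ofReal (2 * Real.pi * u * lam) * (ENNReal.ofReal (M.linkProb q u) *
    ENNReal.ofReal (lamA / lam * (s * P * M.zeta q u / (1 + s * P * M.zeta q u))))

lemma interferenceExponent_zero (lam lamA P : ℝ) (q : LinkType) (c : ℝ) :
    M.interferenceExponent lam lamA P 0 q c = 0 := by
  simp [interferenceExponent]

namespace IsValid

variable (hM : M.IsValid)

include hM

lemma measurable_meanFactor {lam lamA P y s : ℝ} (hlam : 0 < lam) (hlamA : 0 ≤ lamA)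
    (hle : lamA ≤ lam) {R : ℝ → ℝ → Prop} (hR : MeasurableSet {x : ℝ × ℝ | R x.1 x.2}) :
    Measurable (M.meanFactor lam lamA P R y s) := by
  have := isProbabilityMeasure_attributeLaw hlam hlamA hle
  have h := hM.measurable_linkFactor (P := P) (α := ℝ × (ℝ × Bool × ℝ)) (y := fun _ => y)
    (s := fun _ => s) (u := Prod.fst) (e := Prod.snd) hR measurable_const measurable_const
    measurable_fst measurable_snd
  exact h.lintegral_prod_right'

lemma expNeg_lintegral_linkProb (q : LinkType) {lam c : ℝ} (hlam : 0 ≤ lam) (hc : 0 ≤ c) :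
    expNeg (∫⁻ u in Ioc 0 c, ENNReal.ofReal (2 * Real.pi * u * lam) *
        ENNReal.ofReal (M.linkProb q u)) =
      ENNReal.ofReal (Real.exp (-∫ u in (0 : ℝ)..c, M.linkProb q u * (2 * Real.pi * u * lam))) := by
  have hnn : ∀ u ∈ Ioc (0 : ℝ) c, 0 ≤ M.linkProb q u * (2 * Real.pi * u * lam) := fun u hu => by
    have := (hM.linkProb_mem_Icc q u).1
    have := hu.1.le
    positivity
  have hint : IntegrableOn (fun u => M.linkProb q u * (2 * Real.pi * u * lam)) (Ioc 0 c) := by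
    refine Measure.integrableOn_of_bounded (M := 2 * Real.pi * c * lam) (by simp) ?_ ?_
    · exact ((hM.measurable_linkProb q).mul (by fun_prop)).aestronglyMeasurable
    · refine (ae_restrict_iff' measurableSet_Ioc).2 (ae_of_all _ fun u hu => ?_)
      rw [Real.norm_of_nonneg (hnn u hu)]
      have h1 := (hM.linkProb_mem_Icc q u).2
      have h0 := hu.1.le
      have h2 := hu.2
      calc M.linkProb q u * (2 * Real.pi * u * lam) ≤ 1 * (2 * Real.pi * c * lam) := by gcongr
        _ = _ := one_mul _
  rw [intervalIntegral.integral_of_le hc,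
    ← expNeg_ofReal (setIntegral_nonneg measurableSet_Ioc hnn),
    ofReal_integral_eq_lintegral_ofReal hint
      ((ae_restrict_iff' measurableSet_Ioc).2 (ae_of_all _ hnn))]
  congr 1
  refine setLIntegral_congr_fun measurableSet_Ioc fun u hu => ?_
  rw [← ENNReal.ofReal_mul' (hM.linkProb_mem_Icc q u).1, mul_comm]

lemma interferenceExponent_eq {lam lamA P s : ℝ} (hlam : 0 < lam) (hlamA : 0 ≤ lamA)
    (hP : 0 < P) (hs : 0 < s) (q : LinkType) {c : ℝ} (hc : 0 ≤ c) :
    M.interferenceExponent lam lamA P s q c =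
      ENNReal.ofReal (2 * Real.pi * lamA) * M.interferenceIntegral P s q c := by
  have hz := measurable_zeta (M := M) q
  have hl := hM.measurable_linkProb q
  rw [interferenceExponent, interferenceIntegral, ← lintegral_const_mul _ (by fun_prop)]
  refine setLIntegral_congr_fun measurableSet_Ioi fun u hu => ?_
  have hu0 : 0 < u := lt_of_le_of_lt hc hu
  have hx : 0 < s * P * M.zeta q u := by have := hM.zeta_pos q hu0; positivity
  have hp := (hM.linkProb_mem_Icc q u).1
  rw [← ENNReal.ofReal_mul hp, ← ENNReal.ofReal_mul (by positivity),
    ← ENNReal.ofReal_mul (by positivity)]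
  congr 1
  generalize s * P * M.zeta q u = x at hx
  have h1 : 1 + x⁻¹ ≠ 0 := by positivity
  field_simp
  ring

lemma laplace_eq {lam lamA P s : ℝ} (hlam : 0 < lam) (hlamA : 0 ≤ lamA) (hP : 0 < P) (hs : 0 < s)
    (p : LinkType) {n : Fin N} {r : ℝ} (hr : r ∈ M.piece n) :
    M.laplace lamA P p n r s = expNeg (M.interferenceExponent lam lamA P s p r) *
      expNeg (M.interferenceExponent lam lamA P s p.other (M.crossing p n r)) := by
  have hr0 := hM.pos_of_mem_piece hr
  have hy : 0 < M.zetaPiece p n r := by rw [← hM.zeta_eq p hr]; exact hM.zeta_pos p hr0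
  rw [laplace, hM.interferenceExponent_eq hlam hlamA hP hs p hr0.le,
    hM.interferenceExponent_eq hlam hlamA hP hs p.other (c := M.crossing p n r)
      (hM.zetaInv_pos p.other hy).le]

/-- The functional `exp (-lam ∫ (1 - H))` of the product over all base stations, for the threshold
`y`: each link type contributes the probability that no base station of this type is stronger than
`y`, and the Laplace transform of the interference from the weaker ones. -/
lemma expNeg_lintegral_meanFactor {lam lamA P y s : ℝ} (hlam : 0 < lam) (hlamA : 0 ≤ lamA)
    (hle : lamA ≤ lam) (hP : 0 < P) (hs : 0 ≤ s) (hy : 0 < y) {R : ℝ → ℝ → Prop}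
    (hR : MeasurableSet {x : ℝ × ℝ | R x.1 x.2}) (hR1 : ∀ b y, b < y → R b y)
    (hR2 : ∀ b y, R b y → b ≤ y) :
    expNeg (ENNReal.ofReal lam * ∫⁻ x : Plane, (1 - M.meanFactor lam lamA P R y s ‖x‖)) =
      ENNReal.ofReal (Real.exp (-∫ u in (0 : ℝ)..M.zetaInv .los y,
          M.linkProb .los u * (2 * Real.pi * u * lam))) *
        expNeg (M.interferenceExponent lam lamA P s .los (M.zetaInv .los y)) *
      (ENNReal.ofReal (Real.exp (-∫ u in (0 : ℝ)..M.zetaInv .nlos y,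
          M.linkProb .nlos u * (2 * Real.pi * u * lam))) *
        expNeg (M.interferenceExponent lam lamA P s .nlos (M.zetaInv .nlos y))) := by
  classical
  let x : LinkType → ℝ → ℝ := fun q u =>
    lamA / lam * (s * P * M.zeta q u / (1 + s * P * M.zeta q u))
  let G : LinkType → ℝ → ℝ≥0∞ := fun q u =>
    if u ≤ M.zetaInv q y then 1 else ENNReal.ofReal (x q u)
  let F : LinkType → ℝ → ℝ≥0∞ := fun q u => ENNReal.ofReal (2 * Real.pi * u * lam) *
    (ENNReal.ofReal (M.linkProb q u) * G q u)
  have hxm : ∀ q, Measurable (x q) := fun q => by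
    have hz := measurable_zeta (M := M) q
    fun_prop
  have hFm : ∀ q, Measurable (F q) := fun q => by
    have hl := hM.measurable_linkProb q
    have hG : Measurable (G q) :=
      Measurable.ite measurableSet_Iic measurable_const (hxm q).ennreal_ofReal
    fun_prop
  have hmm := hM.measurable_meanFactor (P := P) (y := y) (s := s) hlam hlamA hle hR
  -- polar coordinates; the points at which the path loss equals `y` form a null set
  have hpolar : ENNReal.ofReal lam * ∫⁻ x : Plane, (1 - M.meanFactor lam lamA P R y s ‖x‖) =
      ∫⁻ u in Ioi (0 : ℝ), (F .los u + F .nlos u) := by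
    rw [lintegral_norm_plane (fun u => 1 - M.meanFactor lam lamA P R y s u) (hmm.const_sub 1),
      ← lintegral_const_mul _ (by fun_prop)]
    refine lintegral_congr_ae ?_
    have hne : ∀ c : ℝ, ∀ᵐ u ∂(volume.restrict (Ioi (0 : ℝ))), u ≠ c := fun c =>
      ae_restrict_of_ae (by simp [ae_iff])
    filter_upwards [ae_restrict_mem measurableSet_Ioi, hne (M.zetaInv .los y),
      hne (M.zetaInv .nlos y)] with u hu h1 h2
    have hne' : ∀ q, u ≠ M.zetaInv q y := fun q => by cases q <;> assumption
    have hRG : ∀ q, R (M.zeta q u) y ↔ ¬ u ≤ M.zetaInv q y := fun q => by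
      constructor
      · intro h hle
        exact absurd (hR2 _ _ h)
          (not_le.2 (hM.lt_zeta_of_lt_zetaInv q hu (lt_of_le_of_ne hle (hne' q))))
      · exact fun h => hR1 _ _ (hM.zeta_lt_of_zetaInv_lt q hy (not_le.1 h))
    rw [hM.one_sub_meanFactor hlam hlamA hle hP hs hR y hu (fun q => G q u)
      (fun q h => by simp only [G, x, if_neg ((hRG q).1 h)])
      (fun q h => by simp only [G, if_pos (not_not.1 fun h' => h ((hRG q).2 h'))])]
    simp only [F]
    rw [← mul_add, ← mul_assoc, ← ENNReal.ofReal_mul hlam.le]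
    congr 2
    ring
  have hsplit : ∀ q, ∫⁻ u in Ioi (0 : ℝ), F q u =
      (∫⁻ u in Ioc 0 (M.zetaInv q y), ENNReal.ofReal (2 * Real.pi * u * lam) *
        ENNReal.ofReal (M.linkProb q u)) +
      M.interferenceExponent lam lamA P s q (M.zetaInv q y) := by
    intro q
    have hc := (hM.zetaInv_pos q hy).le
    rw [← Ioc_union_Ioi_eq_Ioi hc, lintegral_union measurableSet_Ioi
      (Set.disjoint_left.2 fun u hu hu' => absurd hu.2 (not_le.2 hu'))]
    congr 1
    · refine setLIntegral_congr_fun measurableSet_Ioc fun u hu => ?_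
      simp only [F, G, if_pos hu.2, mul_one]
    · refine setLIntegral_congr_fun measurableSet_Ioi fun u hu => ?_
      simp only [F, G, x, if_neg (not_le.2 (mem_Ioi.1 hu))]
  rw [hpolar, lintegral_add_left (hFm _), hsplit, hsplit, expNeg_add, expNeg_add, expNeg_add,
    hM.expNeg_lintegral_linkProb _ hlam.le (hM.zetaInv_pos _ hy).le,
    hM.expNeg_lintegral_linkProb _ hlam.le (hM.zetaInv_pos _ hy).le]

/-- With the path loss `ζ^p (r)` as threshold, the product functional and the intensity of links of
type `p` combine to the serving distance density and the Laplace transform of the interference. -/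
lemma density_mul_expNeg_lintegral_meanFactor {lam lamA P s : ℝ} (hlam : 0 < lam)
    (hlamA : 0 ≤ lamA) (hle : lamA ≤ lam) (hP : 0 < P) (hs : 0 ≤ s) {R : ℝ → ℝ → Prop}
    (hR : MeasurableSet {x : ℝ × ℝ | R x.1 x.2}) (hR1 : ∀ b y, b < y → R b y)
    (hR2 : ∀ b y, R b y → b ≤ y) (p : LinkType) {n : Fin N} {r : ℝ} (hr : r ∈ M.piece n) :
    ENNReal.ofReal (2 * Real.pi * r * lam) * ENNReal.ofReal (M.linkProb p r) *
        expNeg (ENNReal.ofReal lam *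
          ∫⁻ x : Plane, (1 - M.meanFactor lam lamA P R (M.zeta p r) s ‖x‖)) =
      expNeg (M.interferenceExponent lam lamA P s p r) *
        expNeg (M.interferenceExponent lam lamA P s p.other (M.crossing p n r)) *
        ENNReal.ofReal (M.servingDensity lam p n r) := by
  have hr0 := hM.pos_of_mem_piece hr
  have hy := hM.zeta_pos p hr0
  have h1 : M.zetaInv p (M.zeta p r) = r := hM.zetaInv_eq_of_zeta_eq p hr0 rfl
  have h2 : M.zetaInv p.other (M.zeta p r) = M.crossing p n r := by
    rw [hM.zeta_eq p hr]; rfl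
  have hp := (hM.linkProb_mem_Icc p r).1
  have hd : ENNReal.ofReal (M.servingDensity lam p n r) =
      ENNReal.ofReal (Real.exp (-∫ u in (0 : ℝ)..M.crossing p n r,
        M.linkProb p.other u * (2 * Real.pi * u * lam))) *
      ENNReal.ofReal (Real.exp (-∫ u in (0 : ℝ)..r,
        M.linkProb p u * (2 * Real.pi * u * lam))) *
      ENNReal.ofReal (M.linkProb p r) * ENNReal.ofReal (2 * Real.pi * r * lam) := by
    rw [servingDensity, ← hM.linkProb_eq p hr, ENNReal.ofReal_mul (by positivity),
      ENNReal.ofReal_mul (by positivity), ENNReal.ofReal_mul (by positivity)]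
  rw [hM.expNeg_lintegral_meanFactor hlam hlamA hle hP hs hy hR hR1 hR2, hd]
  cases p <;> simp only [LinkType.other] at h1 h2 ⊢ <;> rw [h1, h2] <;> ring

end IsValid

end PathLossModel

/-! ### Independence of positions and attributes -/

lemma ProbabilityTheory.IndepFun.lintegral_comp_prodMk {Ω α β : Type*} [MeasurableSpace Ω]
    [MeasurableSpace α] [MeasurableSpace β] {μ : Measure Ω} [IsProbabilityMeasure μ]
    {f : Ω → α} {g : Ω → β} (h : IndepFun f g μ) (hf : Measurable f) (hg : Measurable g)
    {Φ : α × β → ℝ≥0∞} (hΦ : Measurable Φ) :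
    ∫⁻ ω, Φ (f ω, g ω) ∂μ = ∫⁻ ω, ∫⁻ ω', Φ (f ω, g ω') ∂μ ∂μ := by
  have hm := (indepFun_iff_map_prod_eq_prod_map_map hf.aemeasurable hg.aemeasurable).1 h
  have : IsProbabilityMeasure (μ.map g) := Measure.isProbabilityMeasure_map hg.aemeasurable
  rw [← lintegral_map (f := Φ) hΦ (hf.prodMk hg), hm, lintegral_prod _ hΦ.aemeasurable,
    lintegral_map (by fun_prop) hf]
  refine lintegral_congr fun ω => ?_
  rw [lintegral_map (by fun_prop) hg]

lemma ProbabilityTheory.iIndepFun.indepFun_update {Ω α : Type*} [MeasurableSpace Ω]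
    [MeasurableSpace α] {μ : Measure Ω} {Z : ℕ → Ω → α} (h : iIndepFun Z μ)
    (hZ : ∀ i, Measurable (Z i)) (i : ℕ) (e₀ : α) :
    IndepFun (Z i) (fun ω => Function.update (fun j => Z j ω) i e₀) μ := by
  have hd : Disjoint ({i} : Set ℕ) {i}ᶜ := disjoint_compl_right
  have hi := indep_iSup_of_disjoint (fun j => (hZ j).comap_le) h.iIndep hd
  have h1 : MeasurableSpace.comap (Z i) inferInstance ≤
      ⨆ j ∈ ({i} : Set ℕ), MeasurableSpace.comap (Z j) inferInstance :=
    le_biSup (fun j => MeasurableSpace.comap (Z j) inferInstance) (mem_singleton i)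
  have h2 : MeasurableSpace.comap (fun ω => Function.update (fun j => Z j ω) i e₀)
      MeasurableSpace.pi ≤
      ⨆ j ∈ ({i} : Set ℕ)ᶜ, MeasurableSpace.comap (Z j) inferInstance := by
    rw [← measurable_iff_comap_le]
    refine @measurable_pi_lambda _ _ _ (_) _ _ fun j => ?_
    by_cases hj : j = i
    · subst hj
      simp only [Function.update_self]
      exact measurable_const
    · simp only [Function.update_of_ne hj]
      exact (comap_measurable (Z j)).mono
        (le_biSup (fun j => MeasurableSpace.comap (Z j) inferInstance) hj) le_rfl
  exact (IndepFun_iff_Indep _ _ _).2 (indep_of_indep_of_le_left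
    (indep_of_indep_of_le_right hi h2) h1)

namespace Network

variable {Ω : Type*} (S : Network Ω)

/-- The attributes (link mark, activity, fading gain) of base station `i`. -/
def attr (i : ℕ) (ω : Ω) : ℝ × Bool × ℝ := (S.mark i ω, S.active i ω, S.gain i ω)

variable {S} [MeasurableSpace Ω] {μ : Measure Ω} {lam lamA : ℝ}

namespace IsModel

variable (hS : S.IsModel μ lam lamA)

include hS

lemma measurable_dist (i : ℕ) : Measurable (S.dist i) := (hS.hppp.measurable i).norm

lemma measurable_attr (i : ℕ) : Measurable (S.attr i) := hS.measurable i

lemma lintegral_attr (i : ℕ) {F : ℝ × Bool × ℝ → ℝ≥0∞} (hF : Measurable F) :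
    ∫⁻ ω, F (S.attr i ω) ∂μ = ∫⁻ e, F e ∂(attributeLaw lam lamA) :=
  (hS.law i).lintegral_comp hF.aemeasurable

variable [IsProbabilityMeasure μ]

/-- The positions, the attributes of base station `i` and the attributes of the others can be
integrated out separately.  The slot of base station `i` among the others is filled by `e₀`. -/
lemma lintegral_selected (i : ℕ) (e₀ : ℝ × Bool × ℝ)
    {Φ : (ℕ → Plane) × (ℝ × Bool × ℝ) × (ℕ → ℝ × Bool × ℝ) → ℝ≥0∞} (hΦ : Measurable Φ) :
    ∫⁻ ω, Φ (fun j => S.loc j ω, S.attr i ω,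
        Function.update (fun j => S.attr j ω) i e₀) ∂μ =
      ∫⁻ ω, ∫⁻ ω', ∫⁻ e, Φ (fun j => S.loc j ω, e,
        Function.update (fun j => S.attr j ω') i e₀) ∂(attributeLaw lam lamA) ∂μ ∂μ := by
  have hX : Measurable fun ω j => S.loc j ω := measurable_pi_lambda _ hS.hppp.measurable
  have hZ : Measurable fun ω j => S.attr j ω := measurable_pi_lambda _ hS.measurable_attr
  have hu : Measurable fun z : ℕ → ℝ × Bool × ℝ => Function.update z i e₀ :=
    measurable_update_left
  have hind := hS.iid.indepFun_update hS.measurable i e₀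
  have h1 := hS.indep.lintegral_comp_prodMk hX hZ
    (Φ := fun p => Φ (p.1, p.2 i, Function.update p.2 i e₀)) (by fun_prop)
  refine h1.trans (lintegral_congr fun ω => ?_)
  have h2 := hind.symm.lintegral_comp_prodMk (hu.comp hZ) (hS.measurable_attr i)
    (Φ := fun p => Φ (fun j => S.loc j ω, p.2, p.1)) (by fun_prop)
  refine h2.trans (lintegral_congr fun ω' => ?_)
  exact hS.lintegral_attr i (F := fun e => Φ (fun j => S.loc j ω, e,
    Function.update (fun j => S.attr j ω') i e₀)) (by fun_prop)

variable {N : ℕ} {M : PathLossModel N}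

/-- Averaging over the attributes of all base stations but one replaces each factor by its mean. -/
lemma lintegral_infProd_linkFactor (hM : M.IsValid) {P : ℝ} {R : ℝ → ℝ → Prop}
    (hR : MeasurableSet {x : ℝ × ℝ | R x.1 x.2}) (y s : ℝ) (u : ℕ → ℝ) (i : ℕ) :
    ∫⁻ ω, infProd (Function.update (fun j => M.linkFactor P R y s (u j) (S.attr j ω)) i 1) ∂μ =
      infProd (Function.update (fun j => M.meanFactor lam lamA P R y s (u j)) i 1) := by
  let f : ℕ → ℝ × Bool × ℝ → ℝ≥0∞ := fun j e =>
    if j = i then 1 else M.linkFactor P R y s (u j) e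
  have hlm : ∀ j, Measurable fun e => M.linkFactor P R y s (u j) e := fun j =>
    hM.measurable_linkFactor (y := fun _ => y) (s := fun _ => s) (u := fun _ => u j)
      (e := fun e => e) hR measurable_const measurable_const measurable_const measurable_id
  have hf : ∀ j, Measurable (f j) := fun j => by
    by_cases h : j = i
    · simp only [f, h, if_true]; exact measurable_const
    · simp only [f, h, if_false]; exact hlm j
  have hupd : ∀ a : ℕ → ℝ≥0∞, Function.update a i 1 = fun j => if j = i then 1 else a j :=
    fun a => by funext j; rw [Function.update_apply]
  have h := lintegral_infProd (hS.iid.comp f hf) (fun j => (hf j).comp (hS.measurable j))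
    (fun j ω => by
      simp only [f, Function.comp_apply]
      split_ifs
      · exact le_rfl
      · exact PathLossModel.linkFactor_le_one _ _ _ _ _ _)
  simp only [hupd]
  refine h.trans ?_
  congr 1
  funext j
  by_cases hj : j = i
  · simp [f, hj]
  · simp only [f, hj, if_false, Function.comp_apply]
    exact hS.lintegral_attr j (hlm j)

/-- The Mecke formula after averaging over the attributes of the base stations that are not
selected. -/
lemma tsum_lintegral_infProd_linkFactor (hM : M.IsValid) (hlam : 0 < lam) (hlamA : 0 ≤ lamA)
    (hle : lamA ≤ lam) {P : ℝ} {R : ℝ → ℝ → Prop}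
    (hR : MeasurableSet {x : ℝ × ℝ | R x.1 x.2}) (hR1 : ∀ b y, b < y → R b y)
    (hR2 : ∀ b y, R b y → b ≤ y) {y s : ℝ → ℝ} (hy : AntitoneOn y (Ioi 0))
    (hs : MonotoneOn s (Ioi 0)) {g : ℝ → ℝ≥0∞} (hg : Measurable g) (hg1 : ∀ r, g r ≤ 1)
    {B : Set ℝ} (hB : MeasurableSet B) (hB0 : B ⊆ Ioi 0) :
    ∑' i, ∫⁻ ω, B.indicator g (S.dist i ω) * ∫⁻ ω', infProd (Function.update (fun j =>
        M.linkFactor P R (y (S.dist i ω)) (s (S.dist i ω)) (S.dist j ω) (S.attr j ω')) i 1) ∂μ ∂μ =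
      ∫⁻ r in B, ENNReal.ofReal (2 * Real.pi * r * lam) * g r * expNeg (ENNReal.ofReal lam *
        ∫⁻ x : Plane, (1 - M.meanFactor lam lamA P R (y r) (s r) ‖x‖)) := by
  have := isProbabilityMeasure_attributeLaw hlam hlamA hle
  have hRmono : ∀ b y y', y ≤ y' → R b y → R b y' := fun b y y' hyy' h => by
    rcases hyy'.lt_or_eq with h' | h'
    · exact hR1 _ _ ((hR2 _ _ h).trans_lt h')
    · rwa [← h']
  have hanti : ∀ x : Plane,
      AntitoneOn (fun r => M.meanFactor lam lamA P R (y r) (s r) ‖x‖) (Ioi 0) := by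
    intro x r hr r' hr' hrr'
    refine lintegral_mono fun e => ?_
    unfold PathLossModel.linkFactor
    refine mul_le_mul' (indicator_le_indicator_of_subset
      (fun b hb => hRmono _ _ _ (hy hr hr' hrr') hb) (fun _ => zero_le) _) ?_
    split_ifs
    · exact antitone_expNeg (mul_le_mul_left (ENNReal.ofReal_le_ofReal (hs hr hr' hrr')) _)
    · exact le_rfl
  have hH1 : ∀ (r : ℝ) (x : Plane), M.meanFactor lam lamA P R (y r) (s r) ‖x‖ ≤ 1 := fun r x =>
    (lintegral_mono fun e => PathLossModel.linkFactor_le_one _ _ _ _ _ _).trans (by simp)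
  rw [← hS.hppp.mecke_radial (H := fun r x => M.meanFactor lam lamA P R (y r) (s r) ‖x‖) hlam.le
    (fun r => (hM.measurable_meanFactor hlam hlamA hle hR).comp measurable_norm) hH1 hanti hg hg1
    hB hB0]
  refine tsum_congr fun i => ?_
  have hm : MeasurableSet {ω | ‖S.loc i ω‖ ∈ B} := hS.measurable_dist i hB
  rw [← lintegral_indicator hm]
  refine lintegral_congr fun ω => ?_
  rw [hS.lintegral_infProd_linkFactor hM hR (y (S.dist i ω)) (s (S.dist i ω))
    (fun j => S.dist j ω) i]
  by_cases h : ‖S.loc i ω‖ ∈ B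
  · rw [indicator_of_mem (show S.dist i ω ∈ B from h),
      indicator_of_mem (show ω ∈ {ω | ‖S.loc i ω‖ ∈ B} from h)]
    rfl
  · rw [indicator_of_notMem (show S.dist i ω ∉ B from h),
      indicator_of_notMem (show ω ∉ {ω | ‖S.loc i ω‖ ∈ B} from h), zero_mul]

end IsModel

end Network

namespace PathLossModel

variable {N : ℕ} (M : PathLossModel N)

/-! ### Interference of the base stations that are not selected -/

/-- The interference from all active base stations except base station `i`, when base station `j`
has distance `u j` and attributes `z j`. -/
noncomputable def othersInterference (P : ℝ) (i : ℕ) (u : ℕ → ℝ) (z : ℕ → ℝ × Bool × ℝ) : ℝ≥0∞ :=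
  ∑' j, if (z j).2.1 = true ∧ j ≠ i then
    ENNReal.ofReal (P * M.pathLossAt (u j) (z j).1 * (z j).2.2) else 0

/-- The product of `linkFactor` over all base stations except base station `i`. -/
noncomputable def othersFactor (P : ℝ) (R : ℝ → ℝ → Prop) (y s : ℝ) (i : ℕ) (u : ℕ → ℝ)
    (z : ℕ → ℝ × Bool × ℝ) : ℝ≥0∞ :=
  infProd (Function.update (fun j => M.linkFactor P R y s (u j) (z j)) i 1)

variable {M}

lemma othersInterference_update (P : ℝ) (i : ℕ) (u : ℕ → ℝ) (z : ℕ → ℝ × Bool × ℝ)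
    (e₀ : ℝ × Bool × ℝ) :
    M.othersInterference P i u (Function.update z i e₀) = M.othersInterference P i u z := by
  refine tsum_congr fun j => ?_
  by_cases h : j = i
  · simp [h]
  · simp [h]

lemma othersFactor_update (P : ℝ) (R : ℝ → ℝ → Prop) (y s : ℝ) (i : ℕ) (u : ℕ → ℝ)
    (z : ℕ → ℝ × Bool × ℝ) (e₀ : ℝ × Bool × ℝ) :
    M.othersFactor P R y s i u (Function.update z i e₀) = M.othersFactor P R y s i u z := by
  unfold othersFactor
  congr 1
  funext j
  by_cases h : j = i
  · simp [h]
  · simp [h]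

lemma linkFactor_zero (P : ℝ) (R : ℝ → ℝ → Prop) (y u : ℝ) (e : ℝ × Bool × ℝ) :
    M.linkFactor P R y 0 u e = {b | R b y}.indicator 1 (M.pathLossAt u e.1) := by
  simp [linkFactor]

/-- The product over the other base stations splits into the event that none of them violates the
threshold, and the exponential of the interference. -/
lemma othersFactor_eq (P : ℝ) (R : ℝ → ℝ → Prop) (y s : ℝ) (i : ℕ) (u : ℕ → ℝ)
    (z : ℕ → ℝ × Bool × ℝ) :
    M.othersFactor P R y s i u z =
      M.othersFactor P R y 0 i u z * expNeg (ENNReal.ofReal s * M.othersInterference P i u z) := by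
  rw [othersInterference, ← ENNReal.tsum_mul_left, expNeg_tsum, othersFactor, othersFactor,
    ← infProd_mul (update_one_le_one (fun j => linkFactor_le_one _ _ _ _ _ _) i)
      fun j => expNeg_le_one _]
  congr 1
  funext j
  by_cases h : j = i
  · simp [h]
  · by_cases ha : (z j).2.1 = true <;> simp [h, ha, linkFactor]

open Classical in
lemma othersFactor_zero (P : ℝ) (R : ℝ → ℝ → Prop) (y : ℝ) (i : ℕ) (u : ℕ → ℝ)
    (z : ℕ → ℝ × Bool × ℝ) :
    M.othersFactor P R y 0 i u z =
      if ∀ j, j ≠ i → R (M.pathLossAt (u j) (z j).1) y then 1 else 0 := by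
  rw [← infProd_indicator fun j => j ≠ i → R (M.pathLossAt (u j) (z j).1) y, othersFactor]
  congr 1
  funext j
  by_cases h : j = i
  · simp [h]
  · simp [h, linkFactor_zero, indicator_apply]

namespace IsValid

variable (hM : M.IsValid)

include hM

lemma measurable_othersInterference {α : Type*} [MeasurableSpace α] (P : ℝ) (i : ℕ)
    {u : α → ℕ → ℝ} {z : α → ℕ → ℝ × Bool × ℝ} (hu : Measurable u) (hz : Measurable z) :
    Measurable fun a => M.othersInterference P i (u a) (z a) := by
  refine Measurable.tsum fun j => ?_
  have huj : Measurable fun a => u a j := (measurable_pi_apply j).comp hu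
  have hzj : Measurable fun a => z a j := (measurable_pi_apply j).comp hz
  have hβ : Measurable fun a => M.pathLossAt (u a j) (z a j).1 :=
    hM.measurable_pathLossAt.comp (huj.prodMk hzj.fst)
  have hg : Measurable fun a => (z a j).2.2 := hzj.snd.snd
  refine Measurable.ite ?_ (by fun_prop) measurable_const
  exact (hzj.snd.fst (measurableSet_singleton true)).inter (MeasurableSet.const _)

lemma measurable_othersFactor {α : Type*} [MeasurableSpace α] {P : ℝ} {R : ℝ → ℝ → Prop}
    (hR : MeasurableSet {x : ℝ × ℝ | R x.1 x.2}) (i : ℕ) {y s : α → ℝ}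
    {u : α → ℕ → ℝ} {z : α → ℕ → ℝ × Bool × ℝ} (hy : Measurable y) (hs : Measurable s)
    (hu : Measurable u) (hz : Measurable z) :
    Measurable fun a => M.othersFactor P R (y a) (s a) i (u a) (z a) := by
  unfold othersFactor
  refine measurable_infProd (f := fun j a => Function.update
    (fun j => M.linkFactor P R (y a) (s a) (u a j) (z a j)) i 1 j) fun j => ?_
  by_cases h : j = i
  · subst h
    simp only [Function.update_self]
    exact measurable_const
  · simp only [Function.update_of_ne h]
    exact hM.measurable_linkFactor hR hy hs ((measurable_pi_apply j).comp hu)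
      ((measurable_pi_apply j).comp hz)

lemma measurableSet_linkTypeAt_eq (p : LinkType) :
    MeasurableSet {x : ℝ × ℝ | M.linkTypeAt x.1 x.2 = p} := by
  have h1 : Measurable fun x : ℝ × ℝ => (M.linkTypeAt x.1 x.2 = p : Prop) :=
    hM.measurable_comp_linkTypeAt (G := fun q _ => (q = p : Prop)) (fun q => measurable_const)
  exact measurableSet_setOfPred.2 h1

lemma attributeLaw_linkTypeAt {lam lamA : ℝ} (hlam : 0 < lam) (hlamA : 0 ≤ lamA)
    (hle : lamA ≤ lam) (p : LinkType) {u : ℝ} (hu : 0 < u) :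
    attributeLaw lam lamA {e | M.linkTypeAt u e.1 = p} = ENNReal.ofReal (M.linkProb p u) := by
  classical
  have hms : MeasurableSet {e : ℝ × Bool × ℝ | M.linkTypeAt u e.1 = p} :=
    (measurable_const.prodMk measurable_fst) (hM.measurableSet_linkTypeAt_eq p)
  have hκ : ENNReal.ofReal (lamA / lam) + ENNReal.ofReal (1 - lamA / lam) = 1 := by
    rw [← ENNReal.ofReal_add (by positivity) (sub_nonneg.2 (div_le_one_of_le₀ hle hlam.le))]
    simp
  rw [← lintegral_indicator_one hms, lintegral_attributeLaw _ _ (measurable_one.indicator hms)]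
  have hg : ∀ (m : ℝ) (b : Bool), ∫⁻ g, {e : ℝ × Bool × ℝ | M.linkTypeAt u e.1 = p}.indicator
      1 (m, b, g) ∂(expMeasure 1) = if M.linkTypeAt u m = p then 1 else 0 := by
    intro m b
    by_cases h : M.linkTypeAt u m = p <;> simp [h]
  simp only [hg, ← add_mul, hκ, one_mul]
  rw [hM.lintegral_linkTypeAt hu fun q => if q = p then 1 else 0]
  cases p <;> simp

end IsValid

end PathLossModel

namespace Network

variable {Ω : Type*} {S : Network Ω} [MeasurableSpace Ω] {μ : Measure Ω} {lam lamA : ℝ}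

namespace IsModel

variable [IsProbabilityMeasure μ] (hS : S.IsModel μ lam lamA)

include hS

variable {N : ℕ} {M : PathLossModel N}

/-- The master formula: the sum over all base stations `i` of the expectation of a functional of the
distance and the attributes of `i` and of the interference of the others, on the event that the
others are weaker than a link of type `p` at the distance of `i`.  It is assumed that averaging
over the attributes of `i` turns the dependence on the interference into an exponential. -/
lemma tsum_lintegral_othersFactor (hM : M.IsValid) (hlam : 0 < lam) (hlamA : 0 ≤ lamA)
    (hle : lamA ≤ lam) {P : ℝ} {R : ℝ → ℝ → Prop}
    (hR : MeasurableSet {x : ℝ × ℝ | R x.1 x.2}) (hR1 : ∀ b y, b < y → R b y)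
    (hR2 : ∀ b y, R b y → b ≤ y) (p : LinkType) {s : ℝ → ℝ} (hs : MonotoneOn s (Ioi 0))
    {g : ℝ → ℝ≥0∞} (hg : Measurable g) (hg1 : ∀ r, g r ≤ 1)
    {V : ℝ × (ℝ × Bool × ℝ) × ℝ≥0∞ → ℝ≥0∞} (hV : Measurable V)
    (hVg : ∀ u, 0 < u → ∀ I, ∫⁻ e, V (u, e, I) ∂(attributeLaw lam lamA) =
      g u * expNeg (ENNReal.ofReal (s u) * I))
    {B : Set ℝ} (hB : MeasurableSet B) (hB0 : B ⊆ Ioi 0) :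
    ∑' i, ∫⁻ ω, B.indicator 1 (S.dist i ω) *
        M.othersFactor P R (M.zeta p (S.dist i ω)) 0 i (fun j => S.dist j ω)
          (fun j => S.attr j ω) *
        V (S.dist i ω, S.attr i ω,
          M.othersInterference P i (fun j => S.dist j ω) (fun j => S.attr j ω)) ∂μ =
      ∫⁻ r in B, ENNReal.ofReal (2 * Real.pi * r * lam) * g r * expNeg (ENNReal.ofReal lam *
        ∫⁻ x : Plane, (1 - M.meanFactor lam lamA P R (M.zeta p r) (s r) ‖x‖)) := by
  have hζ := PathLossModel.measurable_zeta (M := M) p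
  rw [← hS.tsum_lintegral_infProd_linkFactor hM hlam hlamA hle hR hR1 hR2
    (hM.zeta_antitone p) hs hg hg1 hB hB0]
  refine tsum_congr fun i => ?_
  let Φ : (ℕ → Plane) × (ℝ × Bool × ℝ) × (ℕ → ℝ × Bool × ℝ) → ℝ≥0∞ := fun a =>
    B.indicator 1 ‖a.1 i‖ *
      M.othersFactor P R (M.zeta p ‖a.1 i‖) 0 i (fun j => ‖a.1 j‖) a.2.2 *
      V (‖a.1 i‖, a.2.1, M.othersInterference P i (fun j => ‖a.1 j‖) a.2.2)
  have hΦ : Measurable Φ := by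
    have hu : Measurable fun a : (ℕ → Plane) × (ℝ × Bool × ℝ) × (ℕ → ℝ × Bool × ℝ) =>
        fun j => ‖a.1 j‖ := measurable_pi_lambda _ fun j => by fun_prop
    have hui : Measurable fun a : (ℕ → Plane) × (ℝ × Bool × ℝ) × (ℕ → ℝ × Bool × ℝ) =>
        ‖a.1 i‖ := by fun_prop
    have hz : Measurable fun a : (ℕ → Plane) × (ℝ × Bool × ℝ) × (ℕ → ℝ × Bool × ℝ) =>
        a.2.2 := by fun_prop
    refine ((measurable_one.indicator hB).comp hui |>.mul ?_).mul ?_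
    · exact hM.measurable_othersFactor hR i (hζ.comp hui) measurable_const hu hz
    · exact hV.comp (hui.prodMk (measurable_snd.fst.prodMk
        (hM.measurable_othersInterference P i hu hz)))
  -- an arbitrary filler: neither functional of the others depends on the slot of `i`
  let e₀ : ℝ × Bool × ℝ := (0, false, 0)
  have h := hS.lintegral_selected i e₀ hΦ
  simp only [Φ, PathLossModel.othersFactor_update, PathLossModel.othersInterference_update] at h
  refine h.trans (lintegral_congr fun ω => ?_)
  have hin : ∀ ω', ∫⁻ e, B.indicator 1 ‖S.loc i ω‖ *
      M.othersFactor P R (M.zeta p ‖S.loc i ω‖) 0 i (fun j => ‖S.loc j ω‖)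
        (fun j => S.attr j ω') *
      V (‖S.loc i ω‖, e, M.othersInterference P i (fun j => ‖S.loc j ω‖) fun j => S.attr j ω')
        ∂(attributeLaw lam lamA) =
      B.indicator g ‖S.loc i ω‖ * M.othersFactor P R (M.zeta p ‖S.loc i ω‖) (s ‖S.loc i ω‖) i
        (fun j => ‖S.loc j ω‖) (fun j => S.attr j ω') := by
    intro ω'
    rw [lintegral_const_mul _ (by fun_prop)]
    by_cases hi : ‖S.loc i ω‖ ∈ B
    · rw [hVg _ (hB0 hi), indicator_of_mem hi, indicator_of_mem hi,
        PathLossModel.othersFactor_eq P R _ (s ‖S.loc i ω‖), Pi.one_apply]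
      ring
    · simp [hi]
  have hm : Measurable fun ω' => M.othersFactor P R (M.zeta p ‖S.loc i ω‖) (s ‖S.loc i ω‖) i
      (fun j => ‖S.loc j ω‖) (fun j => S.attr j ω') :=
    hM.measurable_othersFactor (y := fun _ => M.zeta p ‖S.loc i ω‖)
      (s := fun _ => s ‖S.loc i ω‖) (u := fun _ j => ‖S.loc j ω‖) hR i measurable_const
      measurable_const measurable_const (measurable_pi_lambda _ hS.measurable_attr)
  simp only [hin]
  rw [lintegral_const_mul _ hm]
  rfl

end IsModel

end Network

/-! ### The base station offering the strongest link -/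

namespace Network

variable {Ω : Type*} {S : Network Ω} {N : ℕ} {M : PathLossModel N}

/-- The event that base station `i` has a link of type `p` and length in `B`, and that the path
loss `β` of each other base station satisfies `R β y` with `y` the path loss of `i`. -/
def selectedIn (S : Network Ω) (M : PathLossModel N) (R : ℝ → ℝ → Prop) (p : LinkType)
    (B : Set ℝ) (i : ℕ) : Set Ω :=
  {ω | S.dist i ω ∈ B ∧ S.path M i ω = p ∧
    ∀ j, j ≠ i → R (S.beta M j ω) (M.zeta p (S.dist i ω))}

/-- The interference from all active base stations except base station `i`. -/
noncomputable def interferenceWithout (S : Network Ω) (M : PathLossModel N) (P : ℝ) (i : ℕ)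
    (ω : Ω) : ℝ≥0∞ :=
  M.othersInterference P i (fun j => S.dist j ω) fun j => S.attr j ω

lemma isStrongest_of_mem_selectedIn {p : LinkType} {B : Set ℝ} {i : ℕ} {ω : Ω}
    (h : ω ∈ S.selectedIn M (· ≤ ·) p B i) : S.IsStrongest M i ω := by
  intro j
  by_cases hj : j = i
  · rw [hj]
  · refine (h.2.2 j hj).trans (le_of_eq ?_)
    rw [← h.2.1]
    rfl

lemma serving_eq {ω : Ω} (hu : ∃! i, S.IsStrongest M i ω) {i : ℕ} (hi : S.IsStrongest M i ω) :
    S.serving M ω = i := by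
  have : {i | S.IsStrongest M i ω} = {i} := by
    ext j
    exact ⟨fun hj => hu.unique hj hi, fun hj => hj ▸ hi⟩
  rw [serving, this, csInf_singleton]

lemma mem_servedIn_iff {ω : Ω} (hu : ∃! i, S.IsStrongest M i ω) (p : LinkType) (B : Set ℝ) :
    ω ∈ S.servedIn M p B ↔ ∃ i, ω ∈ S.selectedIn M (· ≤ ·) p B i := by
  constructor
  · rintro ⟨hp, hB⟩
    obtain ⟨i, hi⟩ := hu.exists
    have hs := serving_eq hu hi
    rw [servingPath, hs] at hp
    rw [servingDist, hs] at hB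
    refine ⟨i, hB, hp, fun j _ => (hi j).trans (le_of_eq ?_)⟩
    rw [← hp]
    rfl
  · rintro ⟨i, hi⟩
    have hs := serving_eq hu (isStrongest_of_mem_selectedIn hi)
    refine ⟨?_, ?_⟩
    · rw [servingPath, hs]; exact hi.2.1
    · rw [servingDist, hs]; exact hi.1

lemma interference_eq {ω : Ω} (P : ℝ) {i : ℕ} (hi : S.serving M ω = i) :
    S.interference M P ω = S.interferenceWithout M P i ω := by
  subst hi
  refine tsum_congr fun j => ?_
  by_cases h : S.active j ω = true ∧ j ≠ S.serving M ω
  · rw [if_pos h, if_pos (show (S.attr j ω).2.1 = true ∧ j ≠ S.serving M ω from h)]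
    rfl
  · rw [if_neg h, if_neg (show ¬ ((S.attr j ω).2.1 = true ∧ j ≠ S.serving M ω) from h)]

lemma lt_sinr_iff {ω : Ω} {P PN γ : ℝ} (hγ : 0 < γ) {p : LinkType} {B : Set ℝ} {i : ℕ}
    (hu : ∃! i, S.IsStrongest M i ω) (hi : ω ∈ S.selectedIn M (· ≤ ·) p B i) :
    ENNReal.ofReal γ < S.sinr M P PN ω ↔
      ENNReal.ofReal γ * (S.interferenceWithout M P i ω + ENNReal.ofReal PN) <
        ENNReal.ofReal (P * M.zeta p (S.dist i ω) * S.gain i ω) := by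
  have hs := serving_eq hu (isStrongest_of_mem_selectedIn hi)
  have hβ : S.beta M i ω = M.zeta p (S.dist i ω) := by
    rw [← hi.2.1]; rfl
  rw [sinr, interference_eq P hs, hs, hβ,
    ENNReal.lt_div_iff_mul_lt (Or.inr ENNReal.ofReal_ne_top)
      (Or.inr (ENNReal.ofReal_pos.2 hγ).ne')]

/-- The event that `i` is selected, in the product form required by the master formula. -/
lemma indicator_selectedIn (P : ℝ) (R : ℝ → ℝ → Prop) (p : LinkType) (B : Set ℝ) (i : ℕ) (ω : Ω) :
    (S.selectedIn M R p B i).indicator (1 : Ω → ℝ≥0∞) ω =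
      B.indicator 1 (S.dist i ω) *
        M.othersFactor P R (M.zeta p (S.dist i ω)) 0 i (fun j => S.dist j ω)
          (fun j => S.attr j ω) *
        {x : ℝ × ℝ | M.linkTypeAt x.1 x.2 = p}.indicator 1 (S.dist i ω, (S.attr i ω).1) := by
  classical
  rw [PathLossModel.othersFactor_zero]
  have h1 : (∀ j, j ≠ i → R (M.pathLossAt (S.dist j ω) (S.attr j ω).1) (M.zeta p (S.dist i ω))) ↔
    ∀ j, j ≠ i → R (S.beta M j ω) (M.zeta p (S.dist i ω)) := Iff.rfl
  have h2 : (S.dist i ω, (S.attr i ω).1) ∈ {x : ℝ × ℝ | M.linkTypeAt x.1 x.2 = p} ↔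
    S.path M i ω = p := Iff.rfl
  simp only [indicator_apply, h1, h2, selectedIn, mem_ofPred_eq, Pi.one_apply]
  generalize (∀ j, j ≠ i → R (S.beta M j ω) (M.zeta p (S.dist i ω))) = C
  by_cases a : S.dist i ω ∈ B <;> by_cases b : S.path M i ω = p <;> by_cases c : C <;>
    simp [a, b, c]

variable [MeasurableSpace Ω] {μ : Measure Ω} {lam lamA : ℝ}

namespace IsModel

variable (hS : S.IsModel μ lam lamA)

include hS

lemma measurable_beta (hM : M.IsValid) (i : ℕ) : Measurable (S.beta M i) :=
  hM.measurable_pathLossAt.comp ((hS.measurable_dist i).prodMk (hS.measurable_attr i).fst)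

lemma measurable_interferenceWithout (hM : M.IsValid) (P : ℝ) (i : ℕ) :
    Measurable (S.interferenceWithout M P i) :=
  hM.measurable_othersInterference P i (measurable_pi_lambda _ hS.measurable_dist)
    (measurable_pi_lambda _ hS.measurable_attr)

lemma measurableSet_selectedIn (hM : M.IsValid) {R : ℝ → ℝ → Prop}
    (hR : MeasurableSet {x : ℝ × ℝ | R x.1 x.2}) (p : LinkType) {B : Set ℝ}
    (hB : MeasurableSet B) (i : ℕ) : MeasurableSet (S.selectedIn M R p B i) := by
  refine (hS.measurable_dist i hB).inter (MeasurableSet.inter ?_ ?_)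
  · exact ((hS.measurable_dist i).prodMk (hS.measurable_attr i).fst)
      (hM.measurableSet_linkTypeAt_eq p)
  · have : {ω | ∀ j, j ≠ i → R (S.beta M j ω) (M.zeta p (S.dist i ω))} =
        ⋂ j, ⋂ _ : j ≠ i, {ω | R (S.beta M j ω) (M.zeta p (S.dist i ω))} := by
      ext ω; simp
    have hm : MeasurableSet {ω | ∀ j, j ≠ i → R (S.beta M j ω) (M.zeta p (S.dist i ω))} := by
      rw [this]
      exact MeasurableSet.iInter fun j => MeasurableSet.iInter fun _ =>
        ((hS.measurable_beta hM j).prodMk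
          ((PathLossModel.measurable_zeta p).comp (hS.measurable_dist i))) hR
    exact hm

variable [IsProbabilityMeasure μ]

/-- The Laplace transform of the interference of the others, summed over the base stations that
can be selected. -/
lemma tsum_lintegral_selectedIn (hM : M.IsValid) (hlam : 0 < lam) (hlamA : 0 ≤ lamA)
    (hle : lamA ≤ lam) {P s : ℝ} {R : ℝ → ℝ → Prop}
    (hR : MeasurableSet {x : ℝ × ℝ | R x.1 x.2}) (hR1 : ∀ b y, b < y → R b y)
    (hR2 : ∀ b y, R b y → b ≤ y) (p : LinkType)
    {B : Set ℝ} (hB : MeasurableSet B) (hB0 : B ⊆ Ioi 0) :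
    ∑' i, ∫⁻ ω in S.selectedIn M R p B i,
        expNeg (ENNReal.ofReal s * S.interferenceWithout M P i ω) ∂μ =
      ∫⁻ r in B, ENNReal.ofReal (2 * Real.pi * r * lam) * ENNReal.ofReal (M.linkProb p r) *
        expNeg (ENNReal.ofReal lam *
          ∫⁻ x : Plane, (1 - M.meanFactor lam lamA P R (M.zeta p r) s ‖x‖)) := by
  have hms : MeasurableSet {x : ℝ × (ℝ × Bool × ℝ) × ℝ≥0∞ | M.linkTypeAt x.1 x.2.1.1 = p} :=
    (measurable_fst.prodMk measurable_snd.fst.fst) (hM.measurableSet_linkTypeAt_eq p)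
  have h := hS.tsum_lintegral_othersFactor hM hlam hlamA hle (P := P) hR hR1 hR2 p
    (s := fun _ => s) (fun _ _ _ _ _ => le_rfl) (g := fun r => ENNReal.ofReal (M.linkProb p r))
    (hM.measurable_linkProb p).ennreal_ofReal
    (fun r => ENNReal.ofReal_le_one.2 (hM.linkProb_mem_Icc p r).2)
    (V := fun x => {x : ℝ × (ℝ × Bool × ℝ) × ℝ≥0∞ | M.linkTypeAt x.1 x.2.1.1 = p}.indicator 1 x *
      expNeg (ENNReal.ofReal s * x.2.2))
    ((measurable_one.indicator hms).mul (by fun_prop))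
    (fun u hu I => by
      have hm : MeasurableSet {e : ℝ × Bool × ℝ | M.linkTypeAt u e.1 = p} :=
        (measurable_const.prodMk measurable_fst) (hM.measurableSet_linkTypeAt_eq p)
      have := lintegral_indicator_one (μ := attributeLaw lam lamA) hm
      rw [hM.attributeLaw_linkTypeAt hlam hlamA hle p hu] at this
      exact (lintegral_mul_const (expNeg (ENNReal.ofReal s * I))
        (measurable_one.indicator hm)).trans (by rw [this])) hB hB0
  rw [← h]
  refine tsum_congr fun i => ?_
  rw [← lintegral_indicator (hS.measurableSet_selectedIn hM hR p hB i)]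
  refine lintegral_congr fun ω => ?_
  rw [← mul_assoc]
  have h1 := indicator_selectedIn (S := S) (M := M) P R p B i ω
  have h2 : {x : ℝ × (ℝ × Bool × ℝ) × ℝ≥0∞ | M.linkTypeAt x.1 x.2.1.1 = p}.indicator
      (1 : ℝ × (ℝ × Bool × ℝ) × ℝ≥0∞ → ℝ≥0∞) (S.dist i ω, S.attr i ω,
        M.othersInterference P i (fun j => S.dist j ω) fun j => S.attr j ω) =
      {x : ℝ × ℝ | M.linkTypeAt x.1 x.2 = p}.indicator 1 (S.dist i ω, (S.attr i ω).1) := rfl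
  rw [h2, ← h1]
  by_cases hω : ω ∈ S.selectedIn M R p B i
  · rw [indicator_of_mem hω, indicator_of_mem hω, Pi.one_apply, one_mul]
    rfl
  · rw [indicator_of_notMem hω, indicator_of_notMem hω, zero_mul]

/-- The probability that the signal exceeds the scaled interference of the others and noise, summed
over the base stations that can be selected. -/
lemma tsum_measure_selectedIn_inter (hM : M.IsValid) (hlam : 0 < lam) (hlamA : 0 ≤ lamA)
    (hle : lamA ≤ lam) {P PN γ : ℝ} (hP : 0 < P) (hPN : 0 ≤ PN) (hγ : 0 < γ) {R : ℝ → ℝ → Prop}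
    (hR : MeasurableSet {x : ℝ × ℝ | R x.1 x.2}) (hR1 : ∀ b y, b < y → R b y)
    (hR2 : ∀ b y, R b y → b ≤ y) (p : LinkType)
    {B : Set ℝ} (hB : MeasurableSet B) (hB0 : B ⊆ Ioi 0) :
    ∑' i, μ (S.selectedIn M R p B i ∩
        {ω | ENNReal.ofReal γ * (S.interferenceWithout M P i ω + ENNReal.ofReal PN) <
          ENNReal.ofReal (P * M.zeta p (S.dist i ω) * S.gain i ω)}) =
      ∫⁻ r in B, ENNReal.ofReal (2 * Real.pi * r * lam) * (ENNReal.ofReal (M.linkProb p r) *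
        ENNReal.ofReal (Real.exp (-(γ * PN / (P * M.zeta p r))))) *
        expNeg (ENNReal.ofReal lam * ∫⁻ x : Plane,
          (1 - M.meanFactor lam lamA P R (M.zeta p r) (γ / (P * M.zeta p r)) ‖x‖)) := by
  have hζ := PathLossModel.measurable_zeta (M := M) p
  have hl := hM.measurable_linkProb p
  let T : Set (ℝ × (ℝ × Bool × ℝ) × ℝ≥0∞) := {x | M.linkTypeAt x.1 x.2.1.1 = p ∧
    ENNReal.ofReal γ * (x.2.2 + ENNReal.ofReal PN) <
      ENNReal.ofReal (P * M.zeta p x.1 * x.2.1.2.2)}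
  have hT : MeasurableSet T :=
    MeasurableSet.inter ((measurable_fst.prodMk measurable_snd.fst.fst)
      (hM.measurableSet_linkTypeAt_eq p))
      (measurableSet_lt
        (f := fun x : ℝ × (ℝ × Bool × ℝ) × ℝ≥0∞ => ENNReal.ofReal γ * (x.2.2 + ENNReal.ofReal PN))
        (g := fun x : ℝ × (ℝ × Bool × ℝ) × ℝ≥0∞ => ENNReal.ofReal (P * M.zeta p x.1 * x.2.1.2.2))
        (by fun_prop) (by fun_prop))
  have h := hS.tsum_lintegral_othersFactor hM hlam hlamA hle (P := P) hR hR1 hR2 p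
    (s := fun r => γ / (P * M.zeta p r))
    (fun r hr r' hr' hrr' => by
      have h1 := hM.zeta_pos p hr'
      have h2 := hM.zeta_antitone p hr hr' hrr'
      simp only
      gcongr)
    (g := fun r => ENNReal.ofReal (M.linkProb p r) *
      ENNReal.ofReal (Real.exp (-(γ * PN / (P * M.zeta p r))))) (by fun_prop)
    (fun r => by
      refine mul_le_one' (ENNReal.ofReal_le_one.2 (hM.linkProb_mem_Icc p r).2)
        (ENNReal.ofReal_le_one.2 (Real.exp_le_one_iff.2 ?_))
      have := hM.zeta_nonneg p r
      rw [neg_nonpos]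
      positivity)
    (V := T.indicator 1) (measurable_one.indicator hT)
    (fun u hu I => by
      have hz : 0 < P * M.zeta p u := mul_pos hP (hM.zeta_pos p hu)
      have hm : MeasurableSet {e : ℝ × Bool × ℝ | (u, e, I) ∈ T} :=
        (show Measurable fun e : ℝ × Bool × ℝ => (u, e, I) by fun_prop) hT
      have h1 := lintegral_indicator_one (μ := attributeLaw lam lamA) hm
      have h2 := hM.attributeLaw_linkTypeAt_gain hlam hlamA hle hP p hu
        (ENNReal.ofReal γ * (I + ENNReal.ofReal PN))
      refine Eq.trans (h1.trans h2) ?_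
      rw [mul_assoc]
      congr 1
      rw [ENNReal.ofReal_div_of_pos hz, mul_add, add_comm, ENNReal.add_div, expNeg_add]
      congr 1
      · rw [← ENNReal.ofReal_mul hγ.le, ← ENNReal.ofReal_div_of_pos hz,
          expNeg_ofReal (by positivity)]
      · congr 1
        rw [ENNReal.div_eq_inv_mul, ENNReal.div_eq_inv_mul, mul_assoc]) hB hB0
  rw [← h]
  refine tsum_congr fun i => ?_
  have hmE : MeasurableSet {ω | ENNReal.ofReal γ * (S.interferenceWithout M P i ω +
      ENNReal.ofReal PN) < ENNReal.ofReal (P * M.zeta p (S.dist i ω) * S.gain i ω)} := by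
    have h1 := hS.measurable_interferenceWithout hM P i
    have h2 := hS.measurable_dist i
    have h3 : Measurable (S.gain i) := (hS.measurable_attr i).snd.snd
    exact measurableSet_lt (by fun_prop) (by fun_prop)
  rw [← lintegral_indicator_one ((hS.measurableSet_selectedIn hM hR p hB i).inter hmE)]
  refine lintegral_congr fun ω => ?_
  have h1 := indicator_selectedIn (S := S) (M := M) P R p B i ω
  have h2 : T.indicator (1 : ℝ × (ℝ × Bool × ℝ) × ℝ≥0∞ → ℝ≥0∞) (S.dist i ω, S.attr i ω,
      M.othersInterference P i (fun j => S.dist j ω) fun j => S.attr j ω) =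
      {x : ℝ × ℝ | M.linkTypeAt x.1 x.2 = p}.indicator 1 (S.dist i ω, (S.attr i ω).1) *
      {ω | ENNReal.ofReal γ * (S.interferenceWithout M P i ω + ENNReal.ofReal PN) <
          ENNReal.ofReal (P * M.zeta p (S.dist i ω) * S.gain i ω)}.indicator 1 ω :=
    congrFun (inter_indicator_one (M₀ := ℝ≥0∞)
      (s := {x : ℝ × (ℝ × Bool × ℝ) × ℝ≥0∞ | M.linkTypeAt x.1 x.2.1.1 = p})
      (t := {x : ℝ × (ℝ × Bool × ℝ) × ℝ≥0∞ | ENNReal.ofReal γ * (x.2.2 + ENNReal.ofReal PN) <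
        ENNReal.ofReal (P * M.zeta p x.1 * x.2.1.2.2)})) _
  rw [h2, ← mul_assoc, ← h1, inter_indicator_one]
  rfl

end IsModel

end Network

/-! ### Existence and uniqueness of the serving base station -/

namespace Network

variable {Ω : Type*} {S : Network Ω} {N : ℕ} {M : PathLossModel N}

lemma measurableSet_le_prod : MeasurableSet {x : ℝ × ℝ | x.1 ≤ x.2} :=
  measurableSet_le measurable_fst measurable_snd

lemma measurableSet_lt_prod : MeasurableSet {x : ℝ × ℝ | x.1 < x.2} :=
  measurableSet_lt measurable_fst measurable_snd

/-- A strongest link exists as soon as no base station is at the origin and every disc contains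
finitely many of them, since the path loss tends to `0` at infinity. -/
lemma exists_isStrongest (hM : M.IsValid) {ω : Ω} (hpos : ∀ i, 0 < S.dist i ω)
    (hfin : ∀ n : ℕ, {i | S.dist i ω ≤ n}.Finite) : ∃ i, S.IsStrongest M i ω := by
  have hβ : 0 < S.beta M 0 ω := hM.zeta_pos _ (hpos 0)
  obtain ⟨n, hn⟩ := exists_nat_ge
    (max (M.zetaInv .los (S.beta M 0 ω)) (M.zetaInv .nlos (S.beta M 0 ω)))
  have hsub : {j | S.beta M 0 ω ≤ S.beta M j ω} ⊆ {i | S.dist i ω ≤ n} := by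
    intro j hj
    change S.dist j ω ≤ n
    by_contra! hlt
    have h : ∀ q, M.zeta q (S.dist j ω) < S.beta M 0 ω := fun q => by
      refine hM.zeta_lt_of_zetaInv_lt q hβ (lt_of_le_of_lt ?_ hlt)
      cases q
      · exact (le_max_left _ _).trans hn
      · exact (le_max_right _ _).trans hn
    exact absurd hj (not_le.2 (h _))
  obtain ⟨i, hi, hmax⟩ := Set.exists_max_image _ (fun j => S.beta M j ω)
    ((hfin n).subset hsub) ⟨0, le_refl (S.beta M 0 ω)⟩
  refine ⟨i, fun j => ?_⟩
  rcases le_total (S.beta M 0 ω) (S.beta M j ω) with h | h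
  · exact hmax j h
  · exact h.trans hi

variable [MeasurableSpace Ω] {μ : Measure Ω} {lam lamA : ℝ}

namespace IsModel

variable (hS : S.IsModel μ lam lamA)

include hS

lemma ae_dist_pos (hlam : 0 ≤ lam) : ∀ᵐ ω ∂μ, ∀ i, 0 < S.dist i ω := by
  refine ae_all_iff.2 fun i => ?_
  have h := hS.hppp.tsum_measure_preimage hlam (measurableSet_singleton 0) (by simp)
  have h0 : μ (S.loc i ⁻¹' {0}) = 0 := by
    rw [measure_singleton, mul_zero, ENNReal.tsum_eq_zero] at h
    exact h i
  filter_upwards [measure_eq_zero_iff_ae_notMem.1 h0] with ω hω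
  exact norm_pos_iff.2 hω

lemma ae_finite_dist_le : ∀ᵐ ω ∂μ, ∀ n : ℕ, {i | S.dist i ω ≤ n}.Finite := by
  refine ae_all_iff.2 fun n => ?_
  have hB : MeasurableSet (Metric.closedBall (0 : Plane) n) :=
    Metric.isClosed_closedBall.measurableSet
  filter_upwards [hS.hppp.ae_count_ne_top hB measure_closedBall_lt_top.ne] with ω hω
  refine (finite_of_pointProcess_ne_top hB hω).subset fun i hi => ?_
  exact mem_closedBall_zero_iff.2 hi

lemma measurableSet_selectedIn_inter (hM : M.IsValid) {P PN γ : ℝ} (p : LinkType) {B : Set ℝ}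
    (hB : MeasurableSet B) (i : ℕ) :
    MeasurableSet (S.selectedIn M (· ≤ ·) p B i ∩
      {ω | ENNReal.ofReal γ * (S.interferenceWithout M P i ω + ENNReal.ofReal PN) <
        ENNReal.ofReal (P * M.zeta p (S.dist i ω) * S.gain i ω)}) := by
  refine (hS.measurableSet_selectedIn hM measurableSet_le_prod p hB i).inter ?_
  have h1 := hS.measurable_interferenceWithout hM P i
  have h2 := hS.measurable_dist i
  have h3 : Measurable (S.gain i) := (hS.measurable_attr i).snd.snd
  have hζ := PathLossModel.measurable_zeta (M := M) p
  exact measurableSet_lt (by fun_prop) (by fun_prop)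

variable [IsProbabilityMeasure μ]

/-- Ties have probability zero: the expected number of base stations that are at least as strong as
all others and the expected number of those that are strictly stronger are given by the same
formula. -/
lemma ae_selectedIn_lt_of_le (hM : M.IsValid) (hlam : 0 < lam) (hlamA : 0 ≤ lamA)
    (hle : lamA ≤ lam) (p : LinkType) (k i : ℕ) :
    ∀ᵐ ω ∂μ, ω ∈ S.selectedIn M (· ≤ ·) p (Ioc 0 (k : ℝ)) i →
      ω ∈ S.selectedIn M (· < ·) p (Ioc 0 (k : ℝ)) i := by
  have hB : MeasurableSet (Ioc (0 : ℝ) k) := measurableSet_Ioc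
  have hB0 : Ioc (0 : ℝ) k ⊆ Ioi 0 := Ioc_subset_Ioi_self
  have h1 := hS.tsum_lintegral_selectedIn hM hlam hlamA hle (P := 1) (s := 0)
    measurableSet_le_prod (fun _ _ h => h.le) (fun _ _ h => h) p hB hB0
  have h2 := hS.tsum_lintegral_selectedIn hM hlam hlamA hle (P := 1) (s := 0)
    measurableSet_lt_prod (fun _ _ h => h) (fun _ _ h => h.le) p hB hB0
  have h3 : ∑' i, μ (S.selectedIn M (· ≤ ·) p (Ioc 0 (k : ℝ)) i) =
      ∑' i, μ (S.selectedIn M (· < ·) p (Ioc 0 (k : ℝ)) i) := by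
    -- at `s = 0` the Laplace transforms are `1`, and the integrals are the expected numbers
    simp only [ENNReal.ofReal_zero, zero_mul, expNeg_zero, setLIntegral_one] at h1 h2
    rw [h1, h2]
    refine setLIntegral_congr_fun hB fun r hr => ?_
    rw [hM.expNeg_lintegral_meanFactor hlam hlamA hle one_pos le_rfl (hM.zeta_pos p hr.1)
      measurableSet_le_prod (fun _ _ h => h.le) (fun _ _ h => h),
      hM.expNeg_lintegral_meanFactor hlam hlamA hle one_pos le_rfl (hM.zeta_pos p hr.1)
      measurableSet_lt_prod (fun _ _ h => h) (fun _ _ h => h.le)]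
  -- the sets for `<` are contained in those for `≤`, and their measures have the same finite sum
  have hsub : ∀ i, S.selectedIn M (· < ·) p (Ioc 0 (k : ℝ)) i ⊆
      S.selectedIn M (· ≤ ·) p (Ioc 0 (k : ℝ)) i :=
    fun i ω h => ⟨h.1, h.2.1, fun j hj => (h.2.2 j hj).le⟩
  have hfin : ∑' i, μ (S.selectedIn M (· < ·) p (Ioc 0 (k : ℝ)) i) ≠ ∞ := by
    have h := hS.hppp.tsum_measure_preimage hlam.le
      (A := Metric.closedBall (0 : Plane) k) Metric.isClosed_closedBall.measurableSet
      measure_closedBall_lt_top.ne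
    refine ((ENNReal.tsum_le_tsum fun i => measure_mono fun ω hω => ?_).trans_lt
      (h.trans_lt (ENNReal.mul_lt_top ENNReal.ofReal_lt_top measure_closedBall_lt_top))).ne
    exact mem_closedBall_zero_iff.2 hω.1.2
  have heq : μ (S.selectedIn M (· ≤ ·) p (Ioc 0 (k : ℝ)) i) ≤
      μ (S.selectedIn M (· < ·) p (Ioc 0 (k : ℝ)) i) := by
    by_contra! hlt
    exact absurd h3.symm (ENNReal.tsum_lt_tsum hfin (fun j => measure_mono (hsub j)) hlt).ne
  have hae := ae_eq_of_subset_of_measure_ge (hsub i) heq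
    (hS.measurableSet_selectedIn hM measurableSet_lt_prod p hB i).nullMeasurableSet
    (measure_ne_top μ _)
  filter_upwards [hae.mem_iff] with ω hω using hω.2

theorem ae_existsUnique_isStrongest (hM : M.IsValid) (hlam : 0 < lam) (hlamA : 0 ≤ lamA)
    (hle : lamA ≤ lam) : ∀ᵐ ω ∂μ, ∃! i, S.IsStrongest M i ω := by
  have h1 : ∀ p, ∀ᵐ ω ∂μ, ∀ k i : ℕ, ω ∈ S.selectedIn M (· ≤ ·) p (Ioc 0 (k : ℝ)) i →
      ω ∈ S.selectedIn M (· < ·) p (Ioc 0 (k : ℝ)) i := fun p =>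
    ae_all_iff.2 fun k => ae_all_iff.2 fun i => hS.ae_selectedIn_lt_of_le hM hlam hlamA hle p k i
  filter_upwards [hS.ae_dist_pos hlam.le, hS.ae_finite_dist_le, h1 .los, h1 .nlos]
    with ω hpos hfin hlos hnlos
  have hlt : ∀ p, ∀ k i : ℕ, ω ∈ S.selectedIn M (· ≤ ·) p (Ioc 0 (k : ℝ)) i →
      ω ∈ S.selectedIn M (· < ·) p (Ioc 0 (k : ℝ)) i := by
    intro p; cases p <;> assumption
  obtain ⟨i, hi⟩ := exists_isStrongest hM hpos hfin
  refine ⟨i, hi, fun j hj => by_contra fun hji => ?_⟩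
  obtain ⟨k, hk⟩ := exists_nat_ge (S.dist i ω)
  have := (hlt (S.path M i ω) k i ⟨⟨hpos i, hk⟩, rfl, fun j _ => hi j⟩).2.2 j hji
  exact absurd (hj i) (not_le.2 this)

/-! ### The serving link and coverage -/

lemma servedIn_ae_eq (hM : M.IsValid) (hlam : 0 < lam) (hlamA : 0 ≤ lamA) (hle : lamA ≤ lam)
    (p : LinkType) (B : Set ℝ) :
    S.servedIn M p B =ᵐ[μ] ⋃ i, S.selectedIn M (· ≤ ·) p B i := by
  filter_upwards [hS.ae_existsUnique_isStrongest hM hlam hlamA hle] with ω hω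
  exact propext ((mem_servedIn_iff hω p B).trans mem_iUnion.symm)

lemma aedisjoint_selectedIn (hM : M.IsValid) (hlam : 0 < lam) (hlamA : 0 ≤ lamA)
    (hle : lamA ≤ lam) (p : LinkType) (B : Set ℝ) :
    Pairwise (Function.onFun (AEDisjoint μ) (S.selectedIn M (· ≤ ·) p B)) := by
  intro i j hij
  refine measure_eq_zero_iff_ae_notMem.2 ?_
  filter_upwards [hS.ae_existsUnique_isStrongest hM hlam hlamA hle] with ω hω h
  exact hij (hω.unique (isStrongest_of_mem_selectedIn h.1) (isStrongest_of_mem_selectedIn h.2))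

/-- The Laplace transform of the interference on the event of a serving link of given type and
length. -/
lemma lintegral_servedIn (hM : M.IsValid) (hlam : 0 < lam) (hlamA : 0 ≤ lamA) (hle : lamA ≤ lam)
    {P s : ℝ} (hP : 0 < P) (hs : 0 ≤ s) (p : LinkType) (n : Fin N) {B : Set ℝ}
    (hB : MeasurableSet B) (hBn : B ⊆ M.piece n) :
    ∫⁻ ω in S.servedIn M p B, expNeg (ENNReal.ofReal s * S.interference M P ω) ∂μ =
      ∫⁻ r in B, expNeg (M.interferenceExponent lam lamA P s p r) *
        expNeg (M.interferenceExponent lam lamA P s p.other (M.crossing p n r)) *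
        ENNReal.ofReal (M.servingDensity lam p n r) := by
  have hm := hS.measurableSet_selectedIn hM measurableSet_le_prod p hB
  rw [setLIntegral_congr (hS.servedIn_ae_eq hM hlam hlamA hle p B),
    lintegral_iUnion₀ (fun i => (hm i).nullMeasurableSet)
      (hS.aedisjoint_selectedIn hM hlam hlamA hle p B)]
  have h1 : ∀ i, ∫⁻ ω in S.selectedIn M (· ≤ ·) p B i,
      expNeg (ENNReal.ofReal s * S.interference M P ω) ∂μ =
      ∫⁻ ω in S.selectedIn M (· ≤ ·) p B i,
        expNeg (ENNReal.ofReal s * S.interferenceWithout M P i ω) ∂μ := by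
    intro i
    refine lintegral_congr_ae ?_
    filter_upwards [ae_restrict_mem (hm i),
      ae_restrict_of_ae (hS.ae_existsUnique_isStrongest hM hlam hlamA hle)] with ω hω hu
    rw [interference_eq P (serving_eq hu (isStrongest_of_mem_selectedIn hω))]
  simp_rw [h1]
  rw [hS.tsum_lintegral_selectedIn hM hlam hlamA hle measurableSet_le_prod (fun _ _ h => h.le)
    (fun _ _ h => h) p hB fun r hr => hM.pos_of_mem_piece (hBn hr)]
  exact setLIntegral_congr_fun hB fun r hr =>
    hM.density_mul_expNeg_lintegral_meanFactor hlam hlamA hle hP hs measurableSet_le_prod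
      (fun _ _ h => h.le) (fun _ _ h => h) p (hBn hr)

theorem measure_servedIn (hM : M.IsValid) (hlam : 0 < lam) (hlamA : 0 ≤ lamA) (hle : lamA ≤ lam)
    (p : LinkType) (n : Fin N) {B : Set ℝ} (hB : MeasurableSet B) (hBn : B ⊆ M.piece n) :
    μ (S.servedIn M p B) = ∫⁻ r in B, ENNReal.ofReal (M.servingDensity lam p n r) := by
  have h := hS.lintegral_servedIn hM hlam hlamA hle one_pos le_rfl p n hB hBn
  simpa [PathLossModel.interferenceExponent_zero] using h

theorem lintegral_servedIn_expNeg (hM : M.IsValid) (hlam : 0 < lam) (hlamA : 0 ≤ lamA)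
    (hle : lamA ≤ lam) {P s : ℝ} (hP : 0 < P) (hs : 0 < s) (p : LinkType) (n : Fin N) {B : Set ℝ}
    (hB : MeasurableSet B) (hBn : B ⊆ M.piece n) :
    ∫⁻ ω in S.servedIn M p B, expNeg (ENNReal.ofReal s * S.interference M P ω) ∂μ =
      ∫⁻ r in B, M.laplace lamA P p n r s * ENNReal.ofReal (M.servingDensity lam p n r) := by
  rw [hS.lintegral_servedIn hM hlam hlamA hle hP hs.le p n hB hBn]
  refine setLIntegral_congr_fun hB fun r hr => ?_
  rw [hM.laplace_eq hlam hlamA hP hs p (hBn hr)]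

lemma servedIn_inter_ae_eq (hM : M.IsValid) (hlam : 0 < lam) (hlamA : 0 ≤ lamA)
    (hle : lamA ≤ lam) {P PN γ : ℝ} (hγ : 0 < γ) (p : LinkType) (B : Set ℝ) :
    (S.servedIn M p B ∩ {ω | ENNReal.ofReal γ < S.sinr M P PN ω} : Set Ω) =ᵐ[μ]
      ⋃ i, S.selectedIn M (· ≤ ·) p B i ∩
        {ω | ENNReal.ofReal γ * (S.interferenceWithout M P i ω + ENNReal.ofReal PN) <
          ENNReal.ofReal (P * M.zeta p (S.dist i ω) * S.gain i ω)} := by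
  filter_upwards [hS.ae_existsUnique_isStrongest hM hlam hlamA hle] with ω hω
  refine propext ⟨fun h => ?_, fun h => ?_⟩
  · obtain ⟨i, hi⟩ := (mem_servedIn_iff hω p B).1 h.1
    exact mem_iUnion.2 ⟨i, hi, (lt_sinr_iff hγ hω hi).1 h.2⟩
  · obtain ⟨i, hi, hi'⟩ := mem_iUnion.1 h
    exact ⟨(mem_servedIn_iff hω p B).2 ⟨i, hi⟩, (lt_sinr_iff hγ hω hi).2 hi'⟩

/-- Rayleigh fading: on the event of a serving link of given type and length, the success
probability is the Laplace transform of interference and noise at `γ / (P ζ(r))`. -/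
theorem measure_servedIn_inter (hM : M.IsValid) (hlam : 0 < lam) (hlamA : 0 ≤ lamA)
    (hle : lamA ≤ lam) {P PN γ : ℝ} (hP : 0 < P) (hPN : 0 ≤ PN) (hγ : 0 < γ) (p : LinkType)
    (n : Fin N) {B : Set ℝ} (hB : MeasurableSet B) (hBn : B ⊆ M.piece n) :
    μ (S.servedIn M p B ∩ {ω | ENNReal.ofReal γ < S.sinr M P PN ω}) =
      ∫⁻ r in B, M.successProb lamA P PN γ p n r *
        ENNReal.ofReal (M.servingDensity lam p n r) := by
  rw [measure_congr (hS.servedIn_inter_ae_eq hM hlam hlamA hle hγ p B), measure_iUnion₀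
    (fun i j hij => (hS.aedisjoint_selectedIn hM hlam hlamA hle p B hij).mono inter_subset_left
      inter_subset_left)
    fun i => (hS.measurableSet_selectedIn_inter hM p hB i).nullMeasurableSet,
    hS.tsum_measure_selectedIn_inter hM hlam hlamA hle hP hPN hγ measurableSet_le_prod
      (fun _ _ h => h.le) (fun _ _ h => h) p hB fun r hr => hM.pos_of_mem_piece (hBn hr)]
  refine setLIntegral_congr_fun hB fun r hr => ?_
  have hz : 0 < P * M.zeta p r := mul_pos hP (hM.zeta_pos p (hM.pos_of_mem_piece (hBn hr)))
  have hs : 0 < γ / (P * M.zeta p r) := div_pos hγ hz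
  have h := hM.density_mul_expNeg_lintegral_meanFactor hlam hlamA hle hP hs.le
    measurableSet_le_prod (fun _ _ h => h.le) (fun _ _ h => h) p (hBn hr)
  rw [← hM.laplace_eq hlam hlamA hP hs p (hBn hr)] at h
  rw [PathLossModel.successProb, ← hM.zeta_eq p (hBn hr), mul_assoc (ENNReal.ofReal (Real.exp _)),
    ← h]
  ring

theorem coverage_eq (hM : M.IsValid) (hlam : 0 < lam) (hlamA : 0 ≤ lamA)
    (hle : lamA ≤ lam) {P PN γ : ℝ} (hP : 0 < P) (hPN : 0 ≤ PN) (hγ : 0 < γ) :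
    S.coverage M μ P PN γ =
      ∑ n, (M.T lam lamA P PN γ .los n + M.T lam lamA P PN γ .nlos n) := by
  set E : Set Ω := {ω | ENNReal.ofReal γ < S.sinr M P PN ω} with hE
  have hT : ∀ p n, M.T lam lamA P PN γ p n = μ (S.servedIn M p (M.piece n) ∩ E) := fun p n =>
    (hS.measure_servedIn_inter hM hlam hlamA hle hP hPN hγ p n
      (PathLossModel.measurableSet_piece n) subset_rfl).symm
  have hnull : ∀ p n, NullMeasurableSet (S.servedIn M p (M.piece n) ∩ E) μ := fun p n =>
    (MeasurableSet.iUnion fun i => hS.measurableSet_selectedIn_inter hM p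
      (PathLossModel.measurableSet_piece n) i).nullMeasurableSet.congr
      (hS.servedIn_inter_ae_eq hM hlam hlamA hle hγ p (M.piece n)).symm
  have hcov : E =ᵐ[μ] ⋃ n, (S.servedIn M .los (M.piece n) ∩ E ∪
      S.servedIn M .nlos (M.piece n) ∩ E) := by
    filter_upwards [hS.ae_dist_pos hlam.le] with ω hω
    refine propext ⟨fun h => ?_, fun h => ?_⟩
    · obtain ⟨n, hn⟩ := hM.exists_mem_piece (hω (S.serving M ω))
      refine mem_iUnion.2 ⟨n, ?_⟩
      cases hp : S.servingPath M ω
      · exact Or.inl ⟨⟨hp, hn⟩, h⟩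
      · exact Or.inr ⟨⟨hp, hn⟩, h⟩
    · obtain ⟨n, h | h⟩ := mem_iUnion.1 h
      · exact h.2
      · exact h.2
  have hmem : ∀ n ω, ω ∈ S.servedIn M .los (M.piece n) ∩ E ∪ S.servedIn M .nlos (M.piece n) ∩ E →
      S.servingDist M ω ∈ M.piece n := by
    rintro n ω (h | h)
    · exact h.1.2
    · exact h.1.2
  have hdisj : Pairwise (Function.onFun (AEDisjoint μ) fun n =>
      S.servedIn M .los (M.piece n) ∩ E ∪ S.servedIn M .nlos (M.piece n) ∩ E) :=
    fun n m hnm => Disjoint.aedisjoint (Set.disjoint_left.2 fun ω h h' =>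
      hnm (hM.eq_of_mem_piece (hmem n ω h) (hmem m ω h')))
  have hdisj' : ∀ n, AEDisjoint μ (S.servedIn M .los (M.piece n) ∩ E)
      (S.servedIn M .nlos (M.piece n) ∩ E) := fun n =>
    Disjoint.aedisjoint (Set.disjoint_left.2 fun ω h h' =>
      LinkType.noConfusion (h.1.1.symm.trans h'.1.1))
  rw [coverage, ← hE, measure_congr hcov,
    measure_iUnion₀ hdisj fun n => (hnull _ n).union (hnull _ n), tsum_fintype]
  refine Finset.sum_congr rfl fun n _ => ?_
  rw [measure_union₀ (hnull _ n) (hdisj' n), hT, hT]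

end IsModel

end Network

theorem theorem1 {Ω : Type*} [MeasurableSpace Ω] (μ : Measure Ω) [IsProbabilityMeasure μ]
    {N : ℕ} (M : PathLossModel N) (hM : M.IsValid)
    (lam lamA P PN γ : ℝ) (hlam : 0 < lam) (hlamA : 0 ≤ lamA) (hle : lamA ≤ lam)
    (hP : 0 < P) (hPN : 0 ≤ PN) (hγ : 0 < γ)
    (S : Network Ω) (hS : S.IsModel μ lam lamA) :
    -- the serving BS is almost surely well defined
    (∀ᵐ ω ∂μ, ∃! i, S.IsStrongest M i ω) ∧
    -- the distances `r₁` and `r₂` are given by their defining equations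
    (∀ p n, ∀ r ∈ M.piece n,
      (∀ x, 0 < x → M.zeta p.other x = M.zetaPiece p n r → M.crossing p n r = x) ∧
      (ContinuousOn (M.zeta p.other) (Ioi 0) →
        0 < M.crossing p n r ∧ M.zeta p.other (M.crossing p n r) = M.zetaPiece p n r)) ∧
    -- the density of the serving distance, for each type of serving link
    (∀ p n, ∀ B : Set ℝ, MeasurableSet B → B ⊆ M.piece n →
      μ (S.servedIn M p B) = ∫⁻ r in B, ENNReal.ofReal (M.servingDensity lam p n r)) ∧
    -- the Laplace transform of the interference, given the type and length of the serving link
    (∀ p n, ∀ B : Set ℝ, MeasurableSet B → B ⊆ M.piece n → ∀ s : ℝ, 0 < s →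
      ∫⁻ ω in S.servedIn M p B, expNeg (ENNReal.ofReal s * S.interference M P ω) ∂μ =
        ∫⁻ r in B, M.laplace lamA P p n r s *
          ENNReal.ofReal (M.servingDensity lam p n r)) ∧
    -- the success probability, given the type and length of the serving link
    (∀ p n, ∀ B : Set ℝ, MeasurableSet B → B ⊆ M.piece n →
      μ (S.servedIn M p B ∩ {ω | ENNReal.ofReal γ < S.sinr M P PN ω}) =
        ∫⁻ r in B, M.successProb lamA P PN γ p n r *
          ENNReal.ofReal (M.servingDensity lam p n r)) ∧
    -- the coverage probability
    S.coverage M μ P PN γ =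
      ∑ n, (M.T lam lamA P PN γ .los n + M.T lam lamA P PN γ .nlos n) := by
  refine ⟨hS.ae_existsUnique_isStrongest hM hlam hlamA hle, fun p n r hr => ⟨?_, ?_⟩,
    fun p n B hB hBn => hS.measure_servedIn hM hlam hlamA hle p n hB hBn,
    fun p n B hB hBn s hs => hS.lintegral_servedIn_expNeg hM hlam hlamA hle hP hs p n hB hBn,
    fun p n B hB hBn => hS.measure_servedIn_inter hM hlam hlamA hle hP hPN hγ p n hB hBn,
    hS.coverage_eq hM hlam hlamA hle hP hPN hγ⟩
  · exact fun x hx h => hM.zetaInv_eq_of_zeta_eq p.other hx h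
  · have hy : 0 < M.zetaPiece p n r := by
      rw [← hM.zeta_eq p hr]; exact hM.zeta_pos p (hM.pos_of_mem_piece hr)
    exact fun hc => ⟨hM.zetaInv_pos p.other hy, hM.zeta_zetaInv p.other hy hc⟩
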